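/- **Setting.** Let $\mathbb R={}^\omega\omega$ be the Baire space with the metric $d(x,y)=2^{-n}$, $n$ least with $x(n)\ne y(n)$ (and $d(x,x)=0$), and write $\neg A=\mathbb R\setminus A$. $\mathsf L$, $\mathsf{Lip}$ denote the functions $\mathbb R\to\mathbb R$ that are Lipschitz with constant $1$, respectively Lipschitz. For a set $\mathcal F$ of functions $\mathbb R\to\mathbb R$ write $A\le_{\mathcal F}B$ if $A=f^{-1}(B)$ for some $f\in\mathcal F$; $<_{\mathcal F}$, $\equiv_{\mathcal F}$ and $[A]_{\mathcal F}$ are the strict part, the induced equivalence and its classes (degrees). $A$ is $\mathcal F$-selfdual if $A\le_{\mathcal F}\neg A$. $[B]_{\mathcal F}$ is a successor of $[A]_{\mathcal F}$ if $A<_{\mathcal F}B$ and no $C$ satisfies $A<_{\mathcal F}C<_{\mathcal F}B$. Let $\Delta_{\mathcal F}=\{A: A\le_{\mathcal F}\{x:x(0)=0\}\}$. $\mathcal F$ is *Borel-amenable* if it consists of Borel functions, is closed under composition, contains $\mathsf{Lip}$ (hence $\mathsf L$), is a surjective image of $\mathbb R$, and contains $\bigcup_n f_n\restriction D_n$ whenever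 $f_n\in\mathcal F$ and $\langle D_n\rangle_{n\in\omega}$ is a partition of $\mathbb R$ into (possibly empty) sets of $\Delta_{\mathcal F}$; it is of level $\xi$ ($1\le\xi<\omega_1$) if $\Delta_{\mathcal F}=\mathbf\Delta^0_\xi$. An $\mathcal F$-pointclass is a nonempty $\Lambda\subseteq\mathscr P(\mathbb R)$ closed under preimages by functions in $\mathcal F$; its dual is $\breve\Lambda=\{\neg A:A\in\Lambda\}$, and it is nonselfdual if $\breve\Lambda\neq\Lambda$. A set $C$ is $\Lambda$-complete if $C\in\Lambda$ and every $B\in\Lambda$ is a continuous preimage of $C$. **Hypotheses** (in $\mathsf{ZFC}$, with the determinacy axioms localized). Let $\mathcal U\subseteq\mathscr P(\mathbb R)$ contain all Borel sets and be closed under complements and Borel preimages (for instance $\mathcal U$ = the Borel sets; $\mathcal U=\mathscr P(\mathbb R)$ gives the unrestricted axioms). Assume $\mathsf{SLO^L}$ for $\mathcal U$: for all $A,B\in\mathcal U$, $A\le_{\mathsf L}B$ or $\neg B\le_{\mathsf L}A$. Assume $\neg\mathsf{FS}$ for $\mathcal U$: no set in $\mathcal U$ is a flip-set, that is, a set $S\subseteq{}^\omega2\subseteq{}^\omega\omega$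 with $z\in S\iff w\notin S$ for all $z,w\in{}^\omega2$ that differ at exactly one place. Let $\mathcal F$ be Borel-amenable of level $\xi$, $1\le\xi<\omega_1$. **Notation.** $\mathbf\Pi^0_{<\xi}=\bigcup_{\mu<\xi}\mathbf\Pi^0_\mu$, where $\mathbf\Pi^0_0$ denotes the clopen sets. For $A\subseteq\mathbb R$ let $$\mathbf\Gamma^+(A)=\Big\{\bigcup_{n}(F_n\cap A_n): F_n\in\mathbf\Pi^0_{<\xi}\text{ pairwise disjoint},\ A_n<_{\mathcal F}A\Big\}.$$ Fix any bijection $\langle\cdot,\cdot\rangle:\omega\times\omega\to\omega$ and put $\pi_n(x)(m)=x(\langle n,m\rangle)$. Fix any nondecreasing sequence of ordinals $\mu_n<\xi$ cofinal in $\xi$ (i.e. for every $\nu<\xi$ there is $n$ with $\nu\le\mu_n$), and any sets $P_n\in\mathbf\Pi^0_{\mu_n}\setminus\mathbf\Sigma^0_{\mu_n}$ (if $\mu_n=0$: any clopen $P_n\neq\emptyset,\mathbb R$). Put $$\Sigma^\xi(A)=\{x:\exists n\,(\pi_{2n}(x)\in P_n\wedge\forall i<n\ \pi_{2i}(x)\notin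 P_i\wedge\pi_{2n+1}(x)\in A)\},$$ $$\Pi^\xi(A)=\Sigma^\xi(A)\cup\{x:\forall n\ \pi_{2n}(x)\notin P_n\}.$$ For $\alpha<\omega_1$, $\alpha\text{-}\mathbf\Sigma^0_\xi$ is the class of the sets $\{x\in\bigcup_{\eta<\alpha}A_\eta:$ the least $\eta$ with $x\in A_\eta$ has parity opposite to that of $\alpha\}$, for increasing sequences $\langle A_\eta\rangle_{\eta<\alpha}$ of $\mathbf\Sigma^0_\xi$ sets (so $0\text{-}\mathbf\Sigma^0_\xi=\{\emptyset\}$ and $1\text{-}\mathbf\Sigma^0_\xi=\mathbf\Sigma^0_\xi$). **Theorem.** 1. Let $A\in\mathcal U$ be $\mathcal F$-selfdual. Then $\mathbf\Gamma^+(A)$ and its dual are nonselfdual $\mathcal F$-pointclasses that contain $A$ and are included in $\mathcal U$, and they are the smallest ones: every nonselfdual $\mathcal F$-pointclass $\Lambda\subseteq\mathcal U$ with $A\in\Lambda$ equals $\mathbf\Gamma^+(A)$, or equals its dual, or includes both. 2. For such $A$, and for every choice of $\langle\cdot,\cdot\rangle$, $\mu_n$ and $P_n$, the set $\Sigma^\xi(A)$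 is $\mathbf\Gamma^+(A)$-complete and $\Pi^\xi(A)$ is complete for the dual of $\mathbf\Gamma^+(A)$. Moreover $\Pi^\xi(A)\equiv_{\mathcal F}\neg\Sigma^\xi(A)$, $\Sigma^\xi(A)$ is not $\mathcal F$-selfdual, $[\Sigma^\xi(A)]_{\mathcal F}$ and $[\Pi^\xi(A)]_{\mathcal F}$ are successors of $[A]_{\mathcal F}$, and every $B\in\mathcal U$ whose degree is a successor of $[A]_{\mathcal F}$ satisfies $B\equiv_{\mathcal F}\Sigma^\xi(A)$ or $B\equiv_{\mathcal F}\Pi^\xi(A)$. 3. The first $\omega_1$ pairs of nonselfdual $\mathcal F$-pointclasses included in $\mathcal U$, counted from the pair $\{\emptyset\},\{\mathbb R\}$, are the $\alpha\text{-}\mathbf\Sigma^0_\xi$ and their duals, $\alpha<\omega_1$. That is: each $\alpha\text{-}\mathbf\Sigma^0_\xi$ is a nonselfdual $\mathcal F$-pointclass included in $\mathcal U$; for $\alpha<\beta<\omega_1$ both $\alpha\text{-}\mathbf\Sigma^0_\xi$ and its dual are included in $\beta\text{-}\mathbf\Sigma^0_\xi$; and every nonselfdual $\mathcal F$-pointclass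 $\Lambda\subseteq\mathcal U$ either equals $\alpha\text{-}\mathbf\Sigma^0_\xi$ or its dual for some $\alpha<\omega_1$, or includes $\alpha\text{-}\mathbf\Sigma^0_\xi$ and its dual for all $\alpha<\omega_1$. -/

import Mathlib

open scoped Ordinal

namespace BorelAmenable

/-- The Baire space, with the product topology and the product (= Borel) σ-algebra. -/
abbrev Baire : Type := ℕ → ℕ

/-! ### Sets of functions and reducibility -/

/-- The standard distance: `0` if `x = y`, and `2⁻ⁿ` with `n` least such that `x n ≠ y n` otherwise. -/
noncomputable def bdist (x y : Baire) : ℝ := (PiNat.dist (E := fun _ => ℕ)).dist x y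

/-- The functions that are Lipschitz with constant at most `C`. -/
def LipWith (C : ℝ) : Set (Baire → Baire) :=
  {f | ∀ x y, bdist (f x) (f y) ≤ C * bdist x y}

/-- The Lipschitz functions: the union of the sets `LipWith (2 ^ k)`, for `k` an integer. -/
def Lip : Set (Baire → Baire) := {f | ∃ k : ℤ, f ∈ LipWith ((2 : ℝ) ^ k)}

/-- The continuous functions. -/
def W : Set (Baire → Baire) := {f | Continuous f}

/-- `A` is `F`-reducible to `B`. -/
def Red (F : Set (Baire → Baire)) (A B : Set Baire) : Prop := ∃ f ∈ F, A = f ⁻¹' B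

/-- The strict part of `F`-reducibility. -/
def SRed (F : Set (Baire → Baire)) (A B : Set Baire) : Prop := Red F A B ∧ ¬ Red F B A

/-- `A` and `B` have the same `F`-degree. -/
def REquiv (F : Set (Baire → Baire)) (A B : Set Baire) : Prop := Red F A B ∧ Red F B A

/-- `A` is `F`-selfdual. -/
def Selfdual (F : Set (Baire → Baire)) (A : Set Baire) : Prop := Red F A Aᶜ

/-- The degree of `B` is a successor of the degree of `A`. -/
def IsSuccOf (F : Set (Baire → Baire)) (A B : Set Baire) : Prop :=
  SRed F A B ∧ ¬ ∃ C, SRed F A C ∧ SRed F C B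

/-- The characteristic set of `F`: the sets `F`-reducible to the basic open set of all `x` with
`x 0 = 0`. -/
def charSet (F : Set (Baire → Baire)) : Set (Set Baire) := {A | Red F A {x | x 0 = 0}}

/-- `F` is a set of reductions. -/
structure IsSetOfReductions (F : Set (Baire → Baire)) : Prop where
  comp_mem : ∀ f ∈ F, ∀ g ∈ F, g ∘ f ∈ F
  lip_one_subset : LipWith 1 ⊆ F
  exists_surjection : ∃ j : Baire → Baire → Baire, Set.range j = F

/-- `F` is a Borel-amenable set of reductions. -/
structure IsBorelAmenable (F : Set (Baire → Baire)) : Prop extends IsSetOfReductions F where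
  borel : ∀ f ∈ F, Measurable f
  lip_subset : Lip ⊆ F
  glue_mem : ∀ D : ℕ → Set Baire, (∀ n, D n ∈ charSet F) →
    Pairwise (fun m n => Disjoint (D m) (D n)) → (⋃ n, D n) = Set.univ →
    ∀ f : ℕ → Baire → Baire, (∀ n, f n ∈ F) →
    ∀ g : Baire → Baire, (∀ n, ∀ x ∈ D n, g x = f n x) → g ∈ F

/-! ### The Borel hierarchy -/

/-- `IsSigma ξ A`: the set `A` is `𝚺⁰_ξ`, for `1 ≤ ξ` (no set is `IsSigma 0`). -/
inductive IsSigma : Ordinal.{0} → Set Baire → Prop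
  | isOpen (U : Set Baire) : IsOpen U → IsSigma 1 U
  | iUnion (ξ : Ordinal.{0}) (ν : ℕ → Ordinal.{0}) (A : ℕ → Set Baire) : 1 < ξ →
      (∀ n, 1 ≤ ν n ∧ ν n < ξ) → (∀ n, IsSigma (ν n) (A n)ᶜ) → IsSigma ξ (⋃ n, A n)

/-- The pointclass `𝚺⁰_ξ`. -/
def Sig (ξ : Ordinal.{0}) : Set (Set Baire) := {A | IsSigma ξ A}

/-- The pointclass `𝚫⁰_ξ`. -/
def Del (ξ : Ordinal.{0}) : Set (Set Baire) := {A | IsSigma ξ A ∧ IsSigma ξ Aᶜ}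

/-- The pointclass `𝚷⁰_ν`, with the convention that `𝚷⁰_0` is the class of the clopen sets. -/
def PiC (ν : Ordinal.{0}) : Set (Set Baire) := {A | (ν = 0 ∧ IsClopen A) ∨ IsSigma ν Aᶜ}

/-- The pointclass `𝚷⁰_{<ξ}`, the union of the `𝚷⁰_ν` with `ν < ξ`. For `ξ = 1` these are the
clopen sets; for `1 < ξ` the index `0` contributes nothing new. -/
def PiLT (ξ : Ordinal.{0}) : Set (Set Baire) := {A | ∃ ν < ξ, A ∈ PiC ν}

/-! ### Pointclasses -/

/-- The dual of a pointclass. -/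
def dual (Λ : Set (Set Baire)) : Set (Set Baire) := {A | Aᶜ ∈ Λ}

/-- `Λ` is an `F`-pointclass: nonempty and closed under preimages by functions in `F`. -/
def IsPointclass (F : Set (Baire → Baire)) (Λ : Set (Set Baire)) : Prop :=
  Λ.Nonempty ∧ ∀ B ∈ Λ, ∀ f ∈ F, f ⁻¹' B ∈ Λ

/-- `Λ` is a nonselfdual `F`-pointclass. -/
def IsNonselfdualPointclass (F : Set (Baire → Baire)) (Λ : Set (Set Baire)) : Prop :=
  IsPointclass F Λ ∧ dual Λ ≠ Λ

/-- `C` is `Λ`-complete: it is in `Λ` and every set in `Λ` reduces continuously to it. -/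
def IsCompleteFor (Λ : Set (Set Baire)) (C : Set Baire) : Prop := C ∈ Λ ∧ ∀ B ∈ Λ, Red W B C

/-- The difference pointclass `α`-`𝚺⁰_ξ`. Its elements are obtained from the increasing sequences
`(A_η)_{η < α}` of `𝚺⁰_ξ` sets, as the set of the `x` in their union such that the least `η` with
`x ∈ A_η` has parity opposite to that of `α`. For a limit ordinal `l` and a natural number `n`, the
ordinal `l + n` is a left multiple of `2` exactly when `n` is even. -/
def diffClass (α ξ : Ordinal.{0}) : Set (Set Baire) :=
  {C | ∃ A : Ordinal.{0} → Set Baire, (∀ η < α, A η ∈ Sig ξ) ∧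
    (∀ ζ η, ζ ≤ η → η < α → A ζ ⊆ A η) ∧
    C = {x | ∃ η < α, x ∈ A η ∧ (∀ ζ < η, x ∉ A ζ) ∧ (2 ∣ η ↔ ¬ 2 ∣ α)}}

/-! ### The successor construction -/

/-- The pointclass `Γ⁺(A)`. -/
def GammaPlus (F : Set (Baire → Baire)) (ξ : Ordinal.{0}) (A : Set Baire) : Set (Set Baire) :=
  {B | ∃ D C : ℕ → Set Baire, (∀ n, D n ∈ PiLT ξ) ∧
    Pairwise (fun m n => Disjoint (D m) (D n)) ∧ (∀ n, SRed F (C n) A) ∧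
    B = ⋃ n, D n ∩ C n}

/-- The `n`-th projection of the Baire space, for a pairing bijection `e`. -/
def proj (e : ℕ × ℕ ≃ ℕ) (n : ℕ) (x : Baire) : Baire := fun m => x (e (n, m))

/-- The auxiliary data of the construction of level `ξ`: a nondecreasing sequence `μ` of ordinals
cofinal in `ξ`, and sets `P n` that are `𝚷⁰_{μ n}` but not `𝚺⁰_{μ n}`; where `μ n = 0` the set `P n`
is a clopen set other than `∅` and the whole space. -/
structure IsAuxData (ξ : Ordinal.{0}) (μ : ℕ → Ordinal.{0}) (P : ℕ → Set Baire) : Prop where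
  mono : Monotone μ
  lt : ∀ n, μ n < ξ
  cofinal : ∀ ν < ξ, ∃ n, ν ≤ μ n
  mem : ∀ n, P n ∈ PiC (μ n)
  not_mem : ∀ n, μ n ≠ 0 → P n ∉ Sig (μ n)
  ne_empty : ∀ n, P n ≠ ∅
  ne_univ : ∀ n, P n ≠ Set.univ

/-- The set `Σ^ξ(A)`. -/
def SigmaSet (e : ℕ × ℕ ≃ ℕ) (P : ℕ → Set Baire) (A : Set Baire) : Set Baire :=
  {x | ∃ n, proj e (2 * n) x ∈ P n ∧ (∀ i < n, proj e (2 * i) x ∉ P i) ∧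
    proj e (2 * n + 1) x ∈ A}

/-- The set `Π^ξ(A)`. -/
def PiSet (e : ℕ × ℕ ≃ ℕ) (P : ℕ → Set Baire) (A : Set Baire) : Set Baire :=
  SigmaSet e P A ∪ {x | ∀ n, proj e (2 * n) x ∉ P n}

/-! ### The axioms, for the sets in a pointclass -/

/-- The pointclasses over which the axioms are localized: they contain the Borel sets and are closed
under complements and Borel preimages. The collection of all sets is one of them, and so is the
collection of all Borel sets. -/
structure IsSuitable (𝒰 : Set (Set Baire)) : Prop where
  borel_mem : ∀ B : Set Baire, MeasurableSet B → B ∈ 𝒰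
  compl_mem : ∀ B ∈ 𝒰, Bᶜ ∈ 𝒰
  preimage_mem : ∀ B ∈ 𝒰, ∀ f : Baire → Baire, Measurable f → f ⁻¹' B ∈ 𝒰

/-- The semi-linear ordering principle for Lipschitz reductions with constant `1`, for the sets in
`𝒰`. -/
def SLOL (𝒰 : Set (Set Baire)) : Prop :=
  ∀ A ∈ 𝒰, ∀ B ∈ 𝒰, Red (LipWith 1) A B ∨ Red (LipWith 1) Bᶜ A

/-- A flip-set: membership changes whenever exactly one digit is changed. -/
def IsFlipSet (S : Set (ℕ → Bool)) : Prop :=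
  ∀ z w : ℕ → Bool, (∃! n, z n ≠ w n) → (z ∈ S ↔ w ∉ S)

/-- There are no flip-sets in `𝒰`, where the Cantor space is seen as a subspace of the Baire
space. -/
def NoFlipSet (𝒰 : Set (Set Baire)) : Prop :=
  ¬ ∃ S : Set (ℕ → Bool), IsFlipSet S ∧ (fun (z : ℕ → Bool) (n : ℕ) => (z n).toNat) '' S ∈ 𝒰

end BorelAmenable

/-! Let M be `delFunctions ξ`, the set of all functions under which 𝚫⁰_ξ is closed. It contains
every Borel-amenable F of level ξ, and the results on selfdual sets are proved for M and then
transferred.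

The core is `exists_decomposition`: an M-selfdual A in 𝒰 agrees, on the pieces of a countable 𝚺⁰_ξ
partition, with sets strictly below A. This is a Martin–Monk argument. Call a set small if such a
patching exists on it. A large 𝚫⁰_ξ set is the target of one reduction that preserves A and of one
that flips A, and it has large subsets on which any finitely many 𝚫⁰_ξ digits are constant. If the
whole space were large, infinite compositions of such maps, chosen by a binary sequence z, would
converge; continuity witnesses let the limits pass through the maps although these need not be
continuous. Changing one digit of z would then change membership of the limit in A, which gives a
flip-set in 𝒰.

By SLO the pieces can be taken to reduce by Lipschitz maps, and F can glue such maps. Hence F and M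
induce the same reducibility on 𝒰 (`IsAmenable.red_iff_delFunctions`).

The decomposition puts A in Γ⁺(A). This class has a Lipschitz-complete set, so a fixed-point
diagonalization shows it is nonselfdual. A set lying in Γ⁺(A) together with its complement is glued
from sets below A, hence reduces to A. So by SLO a member of Γ⁺(A) that does not reduce to A is
above all other members (`red_of_not_red`); minimality and the description of the successors follow.

For the difference hierarchy, take the least α at which Λ fails to include both classes. Either Λ is
one of the two, or a generator of Λ and its complement are both α-𝚺⁰_ξ; then the generator is glued
from shorter differences and their complements, and would be selfdual. -/

section

open Set Filter Topology

namespace BorelAmenable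

/-! ### Calculus of the Borel hierarchy -/

/-- `x` and `y` have the same first `n` digits. -/
def AgreeTo (n : ℕ) (x y : Baire) : Prop := ∀ i < n, x i = y i

theorem isClopen_of_agreeTo {A : Set Baire} (n : ℕ)
    (h : ∀ x y, AgreeTo n x y → x ∈ A → y ∈ A) : IsClopen A := by
  let r : Baire → (Fin n → ℕ) := fun x i => x i
  have hr : Continuous r := by fun_prop
  have : A = r ⁻¹' (r '' A) := by
    ext y
    constructor
    · intro hy
      exact ⟨y, hy, rfl⟩
    · rintro ⟨x, hx, hxy⟩
      exact h x y (fun i hi => congrFun hxy ⟨i, hi⟩) hx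
  rw [this]
  exact (isClopen_discrete _).preimage hr

theorem exists_agreeTo_subset {U : Set Baire} (hU : IsOpen U) {x : Baire} (hx : x ∈ U) :
    ∃ n, ∀ y, AgreeTo n x y → y ∈ U := by
  obtain ⟨v, ⟨z, n, rfl⟩, hxv, hvU⟩ :=
    (PiNat.isTopologicalBasis_cylinders (fun _ => ℕ)).exists_subset_of_mem_open hx hU
  refine ⟨n, fun y hy => hvU ?_⟩
  rw [PiNat.mem_cylinder_iff] at hxv ⊢
  intro i hi
  rw [← hxv i hi, hy i hi]

/-- Sort the points of U by the length of the shortest cylinder around them that lies in U. Whether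
this length is n depends on the first n digits only. -/
theorem exists_disjoint_clopen {U : Set Baire} (hU : IsOpen U) :
    ∃ V : ℕ → Set Baire, (∀ n, IsClopen (V n)) ∧ Pairwise (fun m n => Disjoint (V m) (V n)) ∧
      U = ⋃ n, V n := by
  classical
  have key : ∀ n x y, AgreeTo n x y → ∀ m ≤ n,
      ((∀ z, AgreeTo m x z → z ∈ U) ↔ (∀ z, AgreeTo m y z → z ∈ U)) := by
    intro n x y hxy m hm
    constructor <;> intro h z hz <;> apply h <;> intro i hi
    · rw [hxy i (by omega), hz i hi]
    · rw [← hxy i (by omega), hz i hi]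
  refine ⟨fun n => {x | (∀ z, AgreeTo n x z → z ∈ U) ∧ ∀ m < n, ¬ ∀ z, AgreeTo m x z → z ∈ U},
    fun n => ?_, ?_, ?_⟩
  · refine isClopen_of_agreeTo n fun x y hxy hx => ?_
    exact ⟨(key n x y hxy n le_rfl).1 hx.1,
      fun m hm h => hx.2 m hm ((key n x y hxy m hm.le).2 h)⟩
  · refine (pairwise_disjoint_on _).2 fun m n hmn => ?_
    rw [Set.disjoint_left]
    intro x hx hx'
    exact hx'.2 m hmn hx.1
  · ext x
    simp only [mem_iUnion, mem_ofPred_eq]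
    constructor
    · intro hx
      have h := exists_agreeTo_subset hU hx
      exact ⟨Nat.find h, Nat.find_spec h, fun m hm => Nat.find_min h hm⟩
    · rintro ⟨n, h, -⟩
      exact h x fun _ _ => rfl

variable {ξ ν : Ordinal.{0}} {A B : Set Baire}

theorem IsSigma.one_le (h : IsSigma ξ A) : 1 ≤ ξ := by
  cases h with
  | isOpen => exact le_rfl
  | iUnion _ ν C h => exact h.le

theorem isSigma_one_iff : IsSigma 1 A ↔ IsOpen A := by
  refine ⟨fun h => ?_, IsSigma.isOpen A⟩
  cases h with
  | isOpen _ h => exact h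
  | iUnion _ ν C h => exact absurd h (lt_irrefl _)

theorem isSigma_iff (hξ : 1 < ξ) : IsSigma ξ A ↔ ∃ (ν : ℕ → Ordinal.{0}) (C : ℕ → Set Baire),
    (∀ n, 1 ≤ ν n ∧ ν n < ξ) ∧ (∀ n, IsSigma (ν n) (C n)ᶜ) ∧ A = ⋃ n, C n := by
  constructor
  · intro h
    cases h with
    | isOpen => exact absurd hξ (lt_irrefl _)
    | iUnion _ ν C _ h1 h2 => exact ⟨ν, C, h1, h2, rfl⟩
  · rintro ⟨ν, C, h1, h2, rfl⟩
    exact .iUnion ξ ν C hξ h1 h2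

theorem IsSigma.of_isOpen (hA : IsOpen A) (hξ : 1 ≤ ξ) : IsSigma ξ A := by
  rcases hξ.eq_or_lt with rfl | h
  · exact .isOpen A hA
  · obtain ⟨V, hV, -, rfl⟩ := exists_disjoint_clopen hA
    exact .iUnion ξ (fun _ => 1) V h (fun _ => ⟨le_rfl, h⟩)
      fun n => .isOpen _ (hV n).compl.isOpen

theorem IsSigma.of_compl (hA : IsSigma ν Aᶜ) (h : ν < ξ) : IsSigma ξ A := by
  have := IsSigma.iUnion ξ (fun _ => ν) (fun _ => A) (hA.one_le.trans_lt h)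
    (fun _ => ⟨hA.one_le, h⟩) fun _ => hA
  rwa [iUnion_const] at this

theorem IsSigma.mono (hA : IsSigma ν A) (h : ν ≤ ξ) : IsSigma ξ A := by
  cases hA with
  | isOpen _ hA => exact .of_isOpen hA h
  | iUnion _ ν C h0 h1 h2 =>
    exact .iUnion ξ ν C (h0.trans_le h) (fun n => ⟨(h1 n).1, (h1 n).2.trans_le h⟩) h2

theorem IsSigma.iUnion_nat {C : ℕ → Set Baire} (hC : ∀ n, IsSigma ξ (C n)) :
    IsSigma ξ (⋃ n, C n) := by
  rcases (hC 0).one_le.eq_or_lt with rfl | h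
  · exact .isOpen _ (isOpen_iUnion fun n => isSigma_one_iff.1 (hC n))
  · choose ν D h1 h2 h3 using fun n => (isSigma_iff h).1 (hC n)
    refine (isSigma_iff h).2 ⟨fun k => ν k.unpair.1 k.unpair.2, fun k => D k.unpair.1 k.unpair.2,
      fun k => h1 _ _, fun k => h2 _ _, ?_⟩
    ext x
    simp only [h3, mem_iUnion]
    constructor
    · rintro ⟨n, m, h⟩
      exact ⟨Nat.pair n m, by simpa using h⟩
    · rintro ⟨k, h⟩
      exact ⟨_, _, h⟩

theorem IsSigma.iUnion_countable {ι : Sort*} [Countable ι] (hξ : 1 ≤ ξ) {C : ι → Set Baire}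
    (hC : ∀ i, IsSigma ξ (C i)) : IsSigma ξ (⋃ i, C i) := by
  rcases isEmpty_or_nonempty ι with h | h
  · rw [iUnion_of_empty]
    exact .of_isOpen isOpen_empty hξ
  · obtain ⟨f, hf⟩ := exists_surjective_nat ι
    rw [← hf.iUnion_comp]
    exact .iUnion_nat fun n => hC _

theorem IsSigma.union (hA : IsSigma ξ A) (hB : IsSigma ξ B) : IsSigma ξ (A ∪ B) := by
  rw [union_eq_iUnion]
  exact .iUnion_countable hA.one_le fun b => by cases b <;> assumption

theorem IsSigma.inter (hA : IsSigma ξ A) (hB : IsSigma ξ B) : IsSigma ξ (A ∩ B) := by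
  rcases hA.one_le.eq_or_lt with rfl | h
  · exact .isOpen _ ((isSigma_one_iff.1 hA).inter (isSigma_one_iff.1 hB))
  · obtain ⟨ν, C, h1, h2, rfl⟩ := (isSigma_iff h).1 hA
    obtain ⟨ν', C', h1', h2', rfl⟩ := (isSigma_iff h).1 hB
    have : (⋃ n, C n) ∩ ⋃ n, C' n = ⋃ n : ℕ × ℕ, C n.1 ∩ C' n.2 := by
      ext x
      simp
    rw [this]
    refine .iUnion_countable hA.one_le fun n => ?_
    refine IsSigma.of_compl (ν := max (ν n.1) (ν' n.2)) ?_ (max_lt (h1 _).2 (h1' _).2)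
    rw [compl_inter]
    exact ((h2 _).mono (le_max_left _ _)).union ((h2' _).mono (le_max_right _ _))

theorem IsSigma.preimage (hA : IsSigma ξ A) {f : Baire → Baire} (hf : Continuous f) :
    IsSigma ξ (f ⁻¹' A) := by
  induction hA with
  | isOpen U hU => exact .isOpen _ (hU.preimage hf)
  | iUnion ξ ν C h0 h1 _ ih =>
    rw [preimage_iUnion]
    exact .iUnion ξ ν _ h0 h1 ih

theorem IsSigma.measurableSet (hA : IsSigma ξ A) : MeasurableSet A := by
  induction hA with
  | isOpen U hU => exact hU.measurableSet
  | iUnion ξ ν C h0 h1 _ ih => exact .iUnion fun n => (ih n).of_compl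

theorem isSigma_finite_iInter {ι : Type*} [Finite ι] (hξ : 1 ≤ ξ) {C : ι → Set Baire}
    (hC : ∀ i, IsSigma ξ (C i)) : IsSigma ξ (⋂ i, C i) := by
  classical
  have := Fintype.ofFinite ι
  have : ∀ s : Finset ι, IsSigma ξ (⋂ i ∈ s, C i) := by
    intro s
    induction s using Finset.induction_on with
    | empty => simpa using IsSigma.of_isOpen isOpen_univ hξ
    | insert a s _ ih =>
      rw [Finset.set_biInter_insert]
      exact (hC a).inter ih
  simpa using this Finset.univ

theorem Del.compl (hA : A ∈ Del ξ) : Aᶜ ∈ Del ξ := ⟨hA.2, by rw [compl_compl]; exact hA.1⟩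

theorem IsClopen.mem_del (hA : IsClopen A) (hξ : 1 ≤ ξ) : A ∈ Del ξ :=
  ⟨.of_isOpen hA.isOpen hξ, .of_isOpen hA.compl.isOpen hξ⟩

theorem IsSigma.mem_del (hA : IsSigma ν A) (h : ν < ξ) : A ∈ Del ξ :=
  ⟨hA.mono h.le, .of_compl (by rwa [compl_compl]) h⟩

theorem Del.inter (hA : A ∈ Del ξ) (hB : B ∈ Del ξ) : A ∩ B ∈ Del ξ :=
  ⟨hA.1.inter hB.1, by rw [compl_inter]; exact hA.2.union hB.2⟩

theorem Del.iInter {ι : Type*} [Finite ι] (hξ : 1 ≤ ξ) {C : ι → Set Baire}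
    (hC : ∀ i, C i ∈ Del ξ) : (⋂ i, C i) ∈ Del ξ :=
  ⟨isSigma_finite_iInter hξ fun i => (hC i).1, by
    rw [compl_iInter]; exact .iUnion_countable hξ fun i => (hC i).2⟩

theorem PiC.mono (hA : A ∈ PiC ν) (h : ν ≤ ξ) : A ∈ PiC ξ := by
  rcases hA with ⟨rfl, hA⟩ | hA
  · rcases eq_or_ne ξ 0 with rfl | h0
    · exact .inl ⟨rfl, hA⟩
    · exact .inr (.of_isOpen hA.compl.isOpen (Order.one_le_iff_ne_zero.2 h0))
  · exact .inr (hA.mono h)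

theorem PiC.mem_del (hA : A ∈ PiC ν) (h : ν < ξ) : A ∈ Del ξ := by
  rcases hA with ⟨rfl, hA⟩ | hA
  · exact IsClopen.mem_del hA (Order.one_le_iff_ne_zero.2 h.ne_bot)
  · exact ⟨hA.of_compl h, hA.mono h.le⟩

theorem PiLT.mem_del (hA : A ∈ PiLT ξ) : A ∈ Del ξ := by
  obtain ⟨ν, h, hA⟩ := hA
  exact PiC.mem_del hA h

theorem IsClopen.mem_piLT (hA : IsClopen A) (hξ : 1 ≤ ξ) : A ∈ PiLT ξ :=
  ⟨0, zero_lt_one.trans_le hξ, .inl ⟨rfl, hA⟩⟩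

theorem PiC.inter (hA : A ∈ PiC ν) (hB : B ∈ PiC ν) : A ∩ B ∈ PiC ν := by
  rcases hA with ⟨rfl, hA⟩ | hA <;> rcases hB with ⟨h0, hB⟩ | hB
  · exact .inl ⟨rfl, hA.inter hB⟩
  · exact absurd hB.one_le (by simp)
  · subst h0
    exact absurd hA.one_le (by simp)
  · right
    rw [compl_inter]
    exact hA.union hB

theorem PiLT.inter (hA : A ∈ PiLT ξ) (hB : B ∈ PiLT ξ) : A ∩ B ∈ PiLT ξ := by
  obtain ⟨ν, h, hA⟩ := hA
  obtain ⟨ν', h', hB⟩ := hB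
  exact ⟨max ν ν', max_lt h h', PiC.inter (PiC.mono hA (le_max_left _ _))
    (PiC.mono hB (le_max_right _ _))⟩

theorem PiLT.iInter {ι : Type*} [Finite ι] (hξ : 1 ≤ ξ) {C : ι → Set Baire}
    (hC : ∀ i, C i ∈ PiLT ξ) : (⋂ i, C i) ∈ PiLT ξ := by
  classical
  have := Fintype.ofFinite ι
  have : ∀ s : Finset ι, (⋂ i ∈ s, C i) ∈ PiLT ξ := by
    intro s
    induction s using Finset.induction_on with
    | empty => simpa using IsClopen.mem_piLT isClopen_univ hξ
    | insert a s _ ih =>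
      rw [Finset.set_biInter_insert]
      exact PiLT.inter (hC a) ih
  simpa using this Finset.univ

/-- A countable disjoint family can be indexed by the natural numbers. -/
theorem exists_nat_reindex {ι : Type*} [Countable ι] (D : ι → Set Baire)
    (hdisj : Pairwise (fun i j => Disjoint (D i) (D j))) (hξ : 1 ≤ ξ) (hD : ∀ i, D i ∈ PiLT ξ) :
    ∃ E : ℕ → Set Baire, (∀ n, E n ∈ PiLT ξ) ∧ Pairwise (fun m n => Disjoint (E m) (E n)) ∧
      ⋃ n, E n = ⋃ i, D i := by
  obtain ⟨c, hc⟩ := exists_injective_nat ι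
  refine ⟨fun n => ⋃ i, ⋃ (_ : c i = n), D i, fun n => ?_, fun m n hmn => ?_, ?_⟩
  · by_cases h : ∃ i, c i = n
    · obtain ⟨i, rfl⟩ := h
      simpa [hc.eq_iff] using hD i
    · push Not at h
      simpa [h] using IsClopen.mem_piLT isClopen_empty hξ
  · refine Set.disjoint_left.2 fun x hx hx' => ?_
    simp only [mem_iUnion] at hx hx'
    obtain ⟨i, rfl, hi⟩ := hx
    obtain ⟨j, rfl, hj⟩ := hx'
    exact Set.disjoint_left.1 (hdisj fun h => hmn (congrArg c h)) hi hj
  · ext x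
    simp

/-- The difference C n \ ⋃ m < n, C m is usually not in 𝚷⁰_{<ξ}. By induction each complement of C m
is a disjoint union of simpler sets E m k, so the difference splits according to the piece E m (k m)
chosen for each m < n. -/
theorem IsSigma.exists_disjoint_piLT (hA : IsSigma ξ A) :
    ∃ D : ℕ → Set Baire, (∀ n, D n ∈ PiLT ξ) ∧ Pairwise (fun m n => Disjoint (D m) (D n)) ∧
      A = ⋃ n, D n := by
  induction hA with
  | isOpen U hU =>
    obtain ⟨V, h1, h2, h3⟩ := exists_disjoint_clopen hU
    exact ⟨V, fun n => IsClopen.mem_piLT (h1 n) le_rfl, h2, h3⟩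
  | iUnion ξ ν C h0 h1 h2 ih =>
    choose E hE hdisj hCE using ih
    let D : (Σ n : ℕ, Fin n → ℕ) → Set Baire := fun i => C i.1 ∩ ⋂ m : Fin i.1, E m (i.2 m)
    have hmem : ∀ m k x, x ∈ E m k → x ∉ C m := fun m k x hx hxC =>
      absurd hxC ((hCE m).symm ▸ mem_iUnion_of_mem k hx : x ∈ (C m)ᶜ)
    have hDd : Pairwise (fun i j => Disjoint (D i) (D j)) := by
      rintro ⟨n, k⟩ ⟨n', k'⟩ hne
      rw [Set.disjoint_left]
      rintro x ⟨hx, hxk⟩ ⟨hx', hxk'⟩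
      simp only [mem_iInter] at hx hx' hxk hxk'
      rcases lt_trichotomy n n' with h | rfl | h
      · exact hmem _ _ _ (hxk' ⟨n, h⟩) hx
      · refine hne ?_
        congr 1
        funext m
        by_contra hm
        exact Set.disjoint_left.1 (hdisj m hm) (hxk m) (hxk' m)
      · exact hmem _ _ _ (hxk ⟨n', h⟩) hx'
    have hDm : ∀ i, D i ∈ PiLT ξ := by
      intro i
      refine PiLT.inter ⟨_, (h1 _).2, .inr (h2 _)⟩ (PiLT.iInter h0.le fun m => ?_)
      obtain ⟨μ, hμ, h⟩ := hE m (i.2 m)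
      exact ⟨μ, hμ.trans (h1 m).2, h⟩
    obtain ⟨G, hG, hG', hGu⟩ := exists_nat_reindex (ξ := ξ) D hDd h0.le hDm
    refine ⟨G, hG, hG', ?_⟩
    rw [hGu]
    ext x
    constructor
    · intro hx
      classical
      have hx := mem_iUnion.1 hx
      have : ∀ m : Fin (Nat.find hx), ∃ k, x ∈ E m k := fun m => by
        have h : x ∈ (C m)ᶜ := Nat.find_min hx m.2
        rw [hCE] at h
        exact mem_iUnion.1 h
      choose k hk using this
      exact mem_iUnion.2 ⟨⟨Nat.find hx, k⟩, Nat.find_spec hx, mem_iInter.2 hk⟩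
    · intro hx
      obtain ⟨i, hi⟩ := mem_iUnion.1 hx
      exact mem_iUnion.2 ⟨_, hi.1⟩

/-- The reduction property of `𝚺⁰_ξ`. -/
theorem exists_reduction {D : ℕ → Set Baire} (hD : ∀ n, IsSigma ξ (D n)) :
    ∃ E : ℕ → Set Baire, (∀ n, IsSigma ξ (E n)) ∧ (∀ n, E n ⊆ D n) ∧
      Pairwise (fun m n => Disjoint (E m) (E n)) ∧ ⋃ n, E n = ⋃ n, D n := by
  choose G hG _ hDG using fun n => (hD n).exists_disjoint_piLT
  -- The 𝚫⁰_ξ pieces of all the D n form one sequence; it is made disjoint and then regrouped by n.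
  let H : ℕ → Set Baire := fun k => G k.unpair.1 k.unpair.2
  have hH : ∀ k, H k ∈ Del ξ := fun k => PiLT.mem_del (hG _ _)
  have hξ : 1 ≤ ξ := (hD 0).one_le
  have hH' : ∀ k, disjointed H k ∈ Del ξ := by
    intro k
    rw [disjointed_eq_inter_compl]
    refine Del.inter (hH k) ?_
    have : (⋂ j < k, (H j)ᶜ) = ⋂ j : Fin k, (H j)ᶜ := by
      ext x
      simp [Fin.forall_iff]
    rw [this]
    exact Del.iInter hξ fun j => Del.compl (hH j)
  refine ⟨fun n => ⋃ m, disjointed H (Nat.pair n m), fun n => .iUnion_nat fun m => (hH' _).1,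
    fun n => ?_, fun m n hmn => ?_, ?_⟩
  · refine iUnion_subset fun m => (disjointed_subset H _).trans ?_
    rw [hDG]
    simpa [H] using subset_iUnion (G n) m
  · refine Set.disjoint_left.2 fun x hx hx' => ?_
    obtain ⟨k, hk⟩ := mem_iUnion.1 hx
    obtain ⟨l, hl⟩ := mem_iUnion.1 hx'
    refine Set.disjoint_left.1 (disjoint_disjointed H fun h => hmn ?_) hk hl
    exact (Nat.pair_eq_pair.1 h).1
  · have h1 : (⋃ n, ⋃ m, disjointed H (Nat.pair n m)) = ⋃ k, disjointed H k := by
      ext x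
      simp only [mem_iUnion]
      constructor
      · rintro ⟨n, m, h⟩
        exact ⟨_, h⟩
      · rintro ⟨k, h⟩
        exact ⟨k.unpair.1, k.unpair.2, by simpa using h⟩
    rw [h1, iUnion_disjointed]
    ext x
    simp only [hDG, mem_iUnion, H]
    constructor
    · rintro ⟨k, h⟩
      exact ⟨_, _, h⟩
    · rintro ⟨n, m, h⟩
      exact ⟨Nat.pair n m, by simpa using h⟩

theorem mem_del_of_partition {E : ℕ → Set Baire} (hE : ∀ n, IsSigma ξ (E n))
    (hdisj : Pairwise (fun m n => Disjoint (E m) (E n))) (hu : ⋃ n, E n = univ) (n : ℕ) :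
    E n ∈ Del ξ := by
  refine ⟨hE n, ?_⟩
  have : (E n)ᶜ = ⋃ m : {m // m ≠ n}, E m := by
    ext x
    simp only [mem_compl_iff, mem_iUnion, Subtype.exists, exists_prop]
    constructor
    · intro hx
      obtain ⟨m, hm⟩ := mem_iUnion.1 (hu.symm ▸ mem_univ x : x ∈ ⋃ n, E n)
      exact ⟨m, fun h => hx (h ▸ hm), hm⟩
    · rintro ⟨m, hmn, hm⟩ hx
      exact Set.disjoint_left.1 (hdisj hmn) hm hx
  rw [this]
  exact .iUnion_countable (hE 0).one_le fun m => hE m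

end BorelAmenable

end

section

open Set Filter Topology

namespace BorelAmenable

variable {ξ ν : Ordinal.{0}} {A B C : Set Baire} {f g : Baire → Baire} {F : Set (Baire → Baire)}

/-! ### Lipschitz functions -/

section Metric

attribute [local instance] PiNat.dist

theorem mem_lipWith_one_iff :
    f ∈ LipWith 1 ↔ ∀ n x y, AgreeTo n x y → AgreeTo n (f x) (f y) := by
  have key : ∀ (n : ℕ) (x y : Baire), AgreeTo n x y ↔ bdist x y ≤ (1 / 2) ^ n := by
    intro n x y
    rw [bdist, ← PiNat.mem_cylinder_iff_dist_le, PiNat.mem_cylinder_iff]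
    exact Iff.rfl
  simp only [key]
  constructor
  · intro hf n x y h
    have := hf x y
    rw [one_mul] at this
    exact this.trans h
  · intro hf x y
    rw [one_mul]
    by_cases hxy : x = y
    · subst hxy
      rw [bdist, bdist, PiNat.dist_self, PiNat.dist_self]
    · have h : bdist x y = (1 / 2) ^ PiNat.firstDiff x y := PiNat.dist_eq_of_ne hxy
      rw [h]
      exact hf _ _ _ h.le

end Metric

theorem continuous_of_mem_lipWith_one (hf : f ∈ LipWith 1) : Continuous f := by
  rw [mem_lipWith_one_iff] at hf
  refine continuous_pi fun n => continuous_discrete_rng.2 fun k => ?_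
  refine (isClopen_of_agreeTo (n + 1) fun x y hxy hx => ?_).isOpen
  rw [mem_preimage, mem_singleton_iff] at hx ⊢
  rw [← hf (n + 1) x y hxy n (Nat.lt_succ_self n), hx]

theorem id_mem_lipWith_one : id ∈ LipWith 1 := mem_lipWith_one_iff.2 fun _ _ _ h => h

theorem const_mem_lipWith_one (b : Baire) : (fun _ => b) ∈ LipWith 1 :=
  mem_lipWith_one_iff.2 fun _ _ _ _ _ _ => rfl

/-- Lipschitz functions computing the columns of a function in parallel. -/
theorem merge_mem_lipWith_one {h : ℕ → Baire → Baire} (hh : ∀ n, h n ∈ LipWith 1) :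
    (fun x k => h k.unpair.1 x k.unpair.2) ∈ LipWith 1 := by
  simp only [mem_lipWith_one_iff] at hh ⊢
  intro n x y hxy i hi
  -- Digit i of the merge is a digit of index at most i of some column. This is special to
  -- `Nat.pair`; an arbitrary pairing only preserves continuity.
  exact hh _ n x y hxy _ ((Nat.unpair_right_le i).trans_lt hi)

theorem continuous_proj (e : ℕ × ℕ ≃ ℕ) (n : ℕ) : Continuous (proj e n) := by
  unfold proj
  fun_prop

theorem proj_merge (h : ℕ → Baire → Baire) (n : ℕ) (x : Baire) :
    proj Nat.pairEquiv n (fun k => h k.unpair.1 x k.unpair.2) = h n x := by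
  funext m
  change h (Nat.unpair (Nat.pair n m)).1 x (Nat.unpair (Nat.pair n m)).2 = h n x m
  rw [Nat.unpair_pair]

/-- A function that gains a digit at each application has a fixed point. -/
theorem exists_fixedPoint (hg : ∀ n x y, AgreeTo n x y → AgreeTo (n + 1) (g x) (g y)) :
    ∃ x, g x = x := by
  have h1 : ∀ n x y, AgreeTo n (g^[n] x) (g^[n] y) := by
    intro n
    induction n with
    | zero => intro x y i hi; omega
    | succ n ih =>
      intro x y
      rw [Function.iterate_succ_apply', Function.iterate_succ_apply']
      exact hg _ _ _ (ih x y)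
  have h2 : ∀ n m x, n ≤ m → AgreeTo n (g^[m] x) (g^[n] x) := by
    intro n m x hnm
    obtain ⟨k, rfl⟩ := Nat.exists_eq_add_of_le hnm
    rw [Function.iterate_add_apply]
    exact h1 n _ _
  let z : Baire := fun _ => 0
  let x : Baire := fun i => g^[i + 1] z i
  have h3 : ∀ n, AgreeTo n x (g^[n] z) := by
    intro n i hi
    exact (h2 (i + 1) n z hi i (Nat.lt_succ_self i)).symm
  refine ⟨x, funext fun i => ?_⟩
  have h4 := hg i _ _ (h3 i) i (Nat.lt_succ_self i)
  rw [h4, ← Function.iterate_succ_apply' g]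

/-- If every set of a pointclass is a Lipschitz preimage of `C`, then the complement of `C` is not
in the pointclass. -/
theorem compl_notMem_of_lipComplete {Λ : Set (Set Baire)}
    (hΛ : ∀ B ∈ Λ, ∀ f, Continuous f → f ⁻¹' B ∈ Λ) (hC : ∀ B ∈ Λ, Red (LipWith 1) B C) :
    Cᶜ ∉ Λ := by
  intro h
  have hs : Continuous (fun (x : Baire) n => x (n + 1)) := by fun_prop
  -- The shift delays the input by one digit, so that x = 0⌢f(x) has a solution. There the shift of
  -- x is f x, and f x is in C exactly if it is not.
  obtain ⟨f, hf, hCf⟩ := hC _ (hΛ _ h _ hs)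
  rw [mem_lipWith_one_iff] at hf
  obtain ⟨x, hx⟩ := exists_fixedPoint (g := fun x n => Nat.casesOn n 0 (f x)) (by
    intro n x y hxy i hi
    cases i with
    | zero => rfl
    | succ i => exact hf n x y hxy i (by omega))
  have hfx : f x = fun n => x (n + 1) := funext fun n => congrFun hx (n + 1)
  have := Set.ext_iff.1 hCf x
  rw [mem_preimage, mem_preimage, hfx, mem_compl_iff] at this
  exact iff_not_self this.symm

/-! ### Reducibility -/

theorem Red.compl (h : Red F A B) : Red F Aᶜ Bᶜ := by
  obtain ⟨f, hf, rfl⟩ := h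
  exact ⟨f, hf, rfl⟩

theorem red_compl_iff : Red F Aᶜ Bᶜ ↔ Red F A B :=
  ⟨fun h => by simpa only [compl_compl] using h.compl, Red.compl⟩

theorem red_compl_comm : Red F A Bᶜ ↔ Red F Aᶜ B := by
  rw [← red_compl_iff, compl_compl]

theorem Red.mono {G : Set (Baire → Baire)} (h : Red F A B) (hFG : F ⊆ G) : Red G A B := by
  obtain ⟨f, hf, hA⟩ := h
  exact ⟨f, hFG hf, hA⟩

theorem Selfdual.compl_red (h : Selfdual F A) : Red F Aᶜ A := red_compl_comm.1 h

theorem Selfdual.ne_univ (h : Selfdual F A) : A ≠ univ := by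
  rintro rfl
  obtain ⟨f, -, hf⟩ := h
  rw [compl_univ, preimage_empty] at hf
  exact univ_nonempty.ne_empty hf

theorem Selfdual.ne_empty (h : Selfdual F A) : A ≠ ∅ := by
  rintro rfl
  obtain ⟨f, -, hf⟩ := h
  rw [compl_empty, preimage_univ] at hf
  exact univ_nonempty.ne_empty hf.symm

/-- The functions under which `𝚫⁰_ξ` is closed. -/
def delFunctions (ξ : Ordinal.{0}) : Set (Baire → Baire) := {f | ∀ D ∈ Del ξ, f ⁻¹' D ∈ Del ξ}

/-- The closure properties of a set of functions that make gluing of reductions possible. -/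
structure IsAmenable (F : Set (Baire → Baire)) (ξ : Ordinal.{0}) : Prop where
  one_le : 1 ≤ ξ
  comp_mem : ∀ f ∈ F, ∀ g ∈ F, g ∘ f ∈ F
  lip_one_subset : LipWith 1 ⊆ F
  subset_delFunctions : F ⊆ delFunctions ξ
  glue_mem : ∀ D : ℕ → Set Baire, (∀ n, D n ∈ Del ξ) →
    Pairwise (fun m n => Disjoint (D m) (D n)) → (⋃ n, D n) = Set.univ →
    ∀ f : ℕ → Baire → Baire, (∀ n, f n ∈ F) →
    ∀ g : Baire → Baire, (∀ n, ∀ x ∈ D n, g x = f n x) → g ∈ F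

theorem IsBorelAmenable.isAmenable (hF : IsBorelAmenable F) (hξ : 1 ≤ ξ)
    (hlevel : charSet F = Del ξ) : IsAmenable F ξ where
  one_le := hξ
  comp_mem := hF.comp_mem
  lip_one_subset := hF.lip_one_subset
  subset_delFunctions := by
    intro f hf D hD
    rw [← hlevel] at hD ⊢
    obtain ⟨g, hg, rfl⟩ := hD
    exact ⟨g ∘ f, hF.comp_mem f hf g hg, rfl⟩
  glue_mem := by
    rw [← hlevel]
    exact hF.glue_mem

/-- Expressing 𝚺⁰_ξ through 𝚫⁰_ξ makes it closed under preimages by `delFunctions ξ`, whose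
definition mentions 𝚫⁰_ξ only. -/
theorem isSigma_iff_iUnion_del :
    IsSigma ξ A ↔ ∃ D : ℕ → Set Baire, (∀ n, D n ∈ Del ξ) ∧ A = ⋃ n, D n := by
  constructor
  · intro h
    obtain ⟨D, hD, -, rfl⟩ := h.exists_disjoint_piLT
    exact ⟨D, fun n => PiLT.mem_del (hD n), rfl⟩
  · rintro ⟨D, hD, rfl⟩
    exact .iUnion_nat fun n => (hD n).1

theorem IsSigma.preimage_of_mem_delFunctions (hA : IsSigma ξ A) (hf : f ∈ delFunctions ξ) :
    IsSigma ξ (f ⁻¹' A) := by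
  rw [isSigma_iff_iUnion_del] at hA ⊢
  obtain ⟨D, hD, rfl⟩ := hA
  exact ⟨fun n => f ⁻¹' D n, fun n => hf _ (hD n), preimage_iUnion⟩

theorem mem_delFunctions_of_continuous (hf : Continuous f) : f ∈ delFunctions ξ :=
  fun _ hD => ⟨hD.1.preimage hf, hD.2.preimage hf⟩

theorem measurable_of_mem_delFunctions (hξ : 1 ≤ ξ) (hf : f ∈ delFunctions ξ) : Measurable f := by
  refine measurable_pi_iff.2 fun n => measurable_to_countable' fun k => ?_
  have : IsClopen {x : Baire | x n = k} :=
    (isClopen_discrete {k}).preimage (continuous_apply n)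
  exact (hf _ (IsClopen.mem_del this hξ)).1.measurableSet

theorem isAmenable_delFunctions (hξ : 1 ≤ ξ) : IsAmenable (delFunctions ξ) ξ where
  one_le := hξ
  comp_mem := fun f hf g hg D hD => hf _ (hg _ hD)
  lip_one_subset := fun f hf => mem_delFunctions_of_continuous (continuous_of_mem_lipWith_one hf)
  subset_delFunctions := Subset.rfl
  glue_mem := by
    intro D hD _ hu f hf g hg
    have key : ∀ E : Set Baire, g ⁻¹' E = ⋃ n, D n ∩ f n ⁻¹' E := by
      intro E
      ext x
      obtain ⟨m, hm⟩ := mem_iUnion.1 (hu.symm ▸ mem_univ x : x ∈ ⋃ n, D n)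
      simp only [mem_preimage, mem_iUnion, mem_inter_iff]
      constructor
      · intro hx
        exact ⟨m, hm, hg m x hm ▸ hx⟩
      · rintro ⟨n, hn, hx⟩
        rwa [hg n x hn]
    have key' : ∀ E ∈ Del ξ, IsSigma ξ (g ⁻¹' E) := fun E hE => by
      rw [key]
      exact .iUnion_nat fun n => (hD n).1.inter (hf n _ hE).1
    exact fun E hE => ⟨key' E hE, key' Eᶜ (Del.compl hE)⟩

namespace IsAmenable

/-- The reduction property shrinks the cover to a partition, and the members of a 𝚺⁰_ξ partition are
𝚫⁰_ξ, as gluing demands. -/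
theorem glue_cover (hF : IsAmenable F ξ) {ι : Type*} [Countable ι] {D : ι → Set Baire} (hD : ∀ i, IsSigma ξ (D i))
    (hu : ∀ x, ∃ i, x ∈ D i) {f : ι → Baire → Baire} (hf : ∀ i, f i ∈ F) :
    ∃ g ∈ F, ∀ x, ∃ i, x ∈ D i ∧ g x = f i x := by
  have : Nonempty ι := ⟨(hu fun _ => 0).choose⟩
  obtain ⟨c, hc⟩ := exists_surjective_nat ι
  obtain ⟨E, hE, hED, hdisj, hEu⟩ := exists_reduction fun n => hD (c n)
  have hu' : ⋃ n, E n = univ := by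
    rw [hEu, hc.iUnion_comp]
    exact eq_univ_of_forall fun x => mem_iUnion.2 (hu x)
  choose n hn using fun x => mem_iUnion.1 (hu'.symm ▸ mem_univ x : x ∈ ⋃ n, E n)
  refine ⟨fun x => f (c (n x)) x, ?_, fun x => ⟨c (n x), hED _ (hn x), rfl⟩⟩
  refine hF.glue_mem E (mem_del_of_partition hE hdisj hu') hdisj hu' (fun n => f (c n))
    (fun n => hf _) _ fun m x hx => ?_
  have : n x = m := by
    by_contra h
    exact Set.disjoint_left.1 (hdisj h) (hn x) hx
  simp only [this]

/-- The main source of reductions. The pieces may overlap, and nothing is asked of C i outside D i.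
-/
theorem red_of_cover (hF : IsAmenable F ξ) {ι : Type*} [Countable ι] {D : ι → Set Baire} (hD : ∀ i, IsSigma ξ (D i))
    (hu : ∀ x, ∃ i, x ∈ D i) {C : ι → Set Baire} (hC : ∀ i, Red F (C i) B)
    (hA : ∀ i, ∀ x ∈ D i, (x ∈ A ↔ x ∈ C i)) : Red F A B := by
  choose f hf hCf using hC
  obtain ⟨g, hg, h⟩ := hF.glue_cover hD hu hf
  refine ⟨g, hg, ?_⟩
  ext x
  obtain ⟨i, hi, hgx⟩ := h x
  rw [hA i x hi, hCf i, mem_preimage, mem_preimage, hgx]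

theorem red_refl (hF : IsAmenable F ξ) (A : Set Baire) : Red F A A := ⟨id, hF.lip_one_subset id_mem_lipWith_one, rfl⟩

theorem red_trans (hF : IsAmenable F ξ) (h : Red F A B) (h' : Red F B C) : Red F A C := by
  obtain ⟨f, hf, rfl⟩ := h
  obtain ⟨g, hg, rfl⟩ := h'
  exact ⟨g ∘ f, hF.comp_mem f hf g hg, rfl⟩

theorem red_of_lip (hF : IsAmenable F ξ) (h : Red (LipWith 1) A B) : Red F A B := h.mono hF.lip_one_subset

theorem red_empty (hF : IsAmenable F ξ) (hA : A ≠ univ) : Red F ∅ A := by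
  obtain ⟨a, ha⟩ := (ne_univ_iff_exists_notMem A).1 hA
  refine ⟨_, hF.lip_one_subset (const_mem_lipWith_one a), ?_⟩
  ext x
  simp [ha]

theorem sred_of_red (hF : IsAmenable F ξ) (h : Red F A B) (h' : SRed F B C) : SRed F A C :=
  ⟨hF.red_trans h h'.1, fun h2 => h'.2 (hF.red_trans h2 h)⟩

theorem sred_compl_of_selfdual (hF : IsAmenable F ξ) (hA : Selfdual F A) (h : SRed F C A) : SRed F Cᶜ A := by
  refine ⟨hF.red_trans h.1.compl (hA.compl_red), fun h2 => h.2 ?_⟩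
  exact hF.red_trans hA (by simpa only [compl_compl] using h2.compl)

theorem mem_of_red (hF : IsAmenable F ξ) {𝒰 : Set (Set Baire)} (h𝒰 : IsSuitable 𝒰) (hB : B ∈ 𝒰) (h : Red F A B) :
    A ∈ 𝒰 := by
  obtain ⟨f, hf, rfl⟩ := h
  exact h𝒰.preimage_mem B hB f
    (measurable_of_mem_delFunctions hF.one_le (hF.subset_delFunctions hf))

end IsAmenable

end BorelAmenable

end

section

open Set Filter Topology

namespace BorelAmenable

variable {ξ ν : Ordinal.{0}} {A B C : Set Baire} {f g : Baire → Baire} {F : Set (Baire → Baire)}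

/-! ### Continuity witnesses -/

/-- All sets given by one digit of `φ` are `𝚫⁰_ξ`. -/
def DelDigits (ξ : Ordinal.{0}) (φ : Baire → Baire) : Prop := ∀ n k, {x | φ x n = k} ∈ Del ξ

/-- Along convergent sequences on which `φ` converges, membership in `A` is continuous. -/
def Tracks (φ : Baire → Baire) (A : Set Baire) : Prop :=
  ∀ (u : ℕ → Baire) (x y : Baire), Tendsto u atTop (𝓝 x) → Tendsto (φ ∘ u) atTop (𝓝 y) →
    ∀ᶠ m in atTop, (u m ∈ A ↔ x ∈ A)

theorem delDigits_of_mem_delFunctions (hξ : 1 ≤ ξ) (hf : f ∈ delFunctions ξ) : DelDigits ξ f :=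
  fun n k => hf _ (IsClopen.mem_del ((isClopen_discrete {k}).preimage (continuous_apply n)) hξ)

theorem DelDigits.comp {φ : Baire → Baire} (hφ : DelDigits ξ φ) (hf : f ∈ delFunctions ξ) :
    DelDigits ξ (φ ∘ f) := fun n k => hf _ (hφ n k)

theorem tendsto_baire_iff {u : ℕ → Baire} {x : Baire} :
    Tendsto u atTop (𝓝 x) ↔ ∀ k, ∀ᶠ m in atTop, u m k = x k := by
  simp [tendsto_pi_nhds, nhds_discrete, tendsto_pure]

theorem IsClopen.tracks (hA : IsClopen A) (φ : Baire → Baire) : Tracks φ A := by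
  intro u x y hu _
  by_cases hx : x ∈ A
  · filter_upwards [hu.eventually (hA.isOpen.mem_nhds hx)] with m hm using iff_of_true hm hx
  · filter_upwards [hu.eventually (hA.compl.isOpen.mem_nhds hx)] with m hm using iff_of_false hm hx

theorem Tracks.compl {φ : Baire → Baire} (h : Tracks φ A) : Tracks φ Aᶜ := by
  intro u x y hu hφ
  filter_upwards [h u x y hu hφ] with m hm
  simp [hm]

/-- The function that computes countably many functions in parallel. -/
def mergeFun (h : ℕ → Baire → Baire) : Baire → Baire := fun x k => h k.unpair.1 x k.unpair.2

theorem mergeFun_pair (h : ℕ → Baire → Baire) (x : Baire) (n k : ℕ) :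
    mergeFun h x (Nat.pair n k) = h n x k := by
  simp [mergeFun]

theorem DelDigits.mergeFun {h : ℕ → Baire → Baire} (hh : ∀ n, DelDigits ξ (h n)) :
    DelDigits ξ (mergeFun h) := fun n k => hh n.unpair.1 n.unpair.2 k

theorem Tracks.mergeFun {h : ℕ → Baire → Baire} {n : ℕ} (hn : Tracks (h n) A) :
    Tracks (mergeFun h) A := by
  intro u x y hu hy
  refine hn u x (fun k => y (Nat.pair n k)) hu (tendsto_baire_iff.2 fun k => ?_)
  filter_upwards [tendsto_baire_iff.1 hy (Nat.pair n k)] with m hm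
  rw [← hm]
  exact (mergeFun_pair h (u m) n k).symm

/-- Besides witnesses for all the D n, φ records in k the first n with x ∈ D n, shifted by one, or 0
if there is none. If k is eventually n + 1 along u, then u is eventually in D n, hence so is the
limit; if k is eventually 0, the limit is in no D n. The union has to be 𝚫⁰_ξ for the value 0 to be
a 𝚫⁰_ξ condition. -/
theorem exists_tracks_iUnion {D : ℕ → Set Baire} (hξ : 1 ≤ ξ) (hD : ∀ n, D n ∈ Del ξ)
    (hu : (⋃ n, D n) ∈ Del ξ) (h : ∀ n, ∃ φ, DelDigits ξ φ ∧ Tracks φ (D n)) :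
    ∃ φ, DelDigits ξ φ ∧ Tracks φ (⋃ n, D n) := by
  classical
  choose φ hφ hT using h
  let k : Baire → ℕ := fun x => if hx : ∃ n, x ∈ D n then Nat.find hx + 1 else 0
  have hk0 : ∀ x, k x = 0 ↔ x ∉ ⋃ n, D n := fun x => by
    by_cases hx : ∃ n, x ∈ D n <;> simp [k, hx]
  have hks : ∀ x n, k x = n + 1 ↔ x ∈ D n ∧ ∀ m < n, x ∉ D m := fun x n => by
    by_cases hx : ∃ n, x ∈ D n
    · simp only [k, hx, dite_true, Nat.add_right_cancel_iff, Nat.find_eq_iff]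
    · simp only [k, hx, dite_false]
      refine iff_of_false (by omega) fun h => hx ⟨n, h.1⟩
  have hkD : ∀ i, {x | k x = i} ∈ Del ξ := by
    rintro (_ | n)
    · have : {x | k x = 0} = (⋃ n, D n)ᶜ := by
        ext x
        exact hk0 x
      rw [this]
      exact Del.compl hu
    · have : {x | k x = n + 1} = D n ∩ ⋂ m : Fin n, (D m)ᶜ := by
        ext x
        simp only [mem_ofPred_eq, hks, mem_inter_iff, mem_iInter, mem_compl_iff, Fin.forall_iff]
      rw [this]
      exact Del.inter (hD n) (Del.iInter hξ fun m => Del.compl (hD m))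
  let h : ℕ → Baire → Baire := fun n => Nat.casesOn n (fun x _ => k x) φ
  refine ⟨mergeFun h, DelDigits.mergeFun fun n => ?_, ?_⟩
  · cases n with
    | zero => exact fun _ i => hkD i
    | succ n => exact hφ n
  · intro u x y hu' hy
    have hT' : ∀ n, Tracks (mergeFun h) (D n) := fun n =>
      Tracks.mergeFun (h := h) (n := n + 1) (hT n)
    have hk : ∀ᶠ m in atTop, k (u m) = y (Nat.pair 0 0) := by
      filter_upwards [tendsto_baire_iff.1 hy (Nat.pair 0 0)] with m hm
      rw [← hm]
      exact (mergeFun_pair h (u m) 0 0).symm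
    rcases hy0 : y (Nat.pair 0 0) with _ | n
    · rw [hy0] at hk
      have hx : x ∉ ⋃ n, D n := by
        simp only [mem_iUnion, not_exists]
        intro n hxn
        obtain ⟨m, hm1, hm2⟩ := (hk.and (hT' n u x y hu' hy)).exists
        exact (hk0 _).1 hm1 (mem_iUnion_of_mem n (hm2.2 hxn))
      filter_upwards [hk] with m hm using iff_of_false ((hk0 _).1 hm) hx
    · rw [hy0] at hk
      filter_upwards [hk, hT' n u x y hu' hy] with m hm1 hm2
      have := ((hks _ _).1 hm1).1
      exact iff_of_true (mem_iUnion_of_mem n this) (mem_iUnion_of_mem n (hm2.1 this))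

theorem IsSigma.exists_tracks (hA : IsSigma ν A) (h : ν < ξ) :
    ∃ φ, DelDigits ξ φ ∧ Tracks φ A := by
  have hid : DelDigits ξ id := delDigits_of_mem_delFunctions (hA.one_le.trans h.le)
    (mem_delFunctions_of_continuous continuous_id)
  induction hA with
  | isOpen U hU =>
    obtain ⟨V, hV, -, rfl⟩ := exists_disjoint_clopen hU
    exact exists_tracks_iUnion h.le (fun n => IsClopen.mem_del (hV n) h.le)
      ((IsSigma.isOpen _ hU).mem_del h) fun n => ⟨id, hid, IsClopen.tracks (hV n) _⟩
  | iUnion ν μ C h0 h1 h2 ih =>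
    refine exists_tracks_iUnion (h0.le.trans h.le) (fun n => ?_)
      ((IsSigma.iUnion ν μ C h0 h1 h2).mem_del h) fun n => ?_
    · rw [← compl_compl (C n)]
      exact Del.compl ((h2 n).mem_del ((h1 n).2.trans h))
    · obtain ⟨φ, hφ, hT⟩ := ih n ((h1 n).2.trans h)
      exact ⟨φ, hφ, by simpa using hT.compl⟩

theorem Del.exists_tracks (hA : A ∈ Del ξ) : ∃ φ, DelDigits ξ φ ∧ Tracks φ A := by
  have hξ := hA.1.one_le
  obtain ⟨D, hD, -, hAD⟩ := hA.1.exists_disjoint_piLT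
  rw [hAD] at hA ⊢
  refine exists_tracks_iUnion hξ (fun n => PiLT.mem_del (hD n)) hA fun n => ?_
  obtain ⟨ν, hν, ⟨rfl, h⟩ | h⟩ := hD n
  · exact ⟨id, delDigits_of_mem_delFunctions hξ (mem_delFunctions_of_continuous continuous_id),
      IsClopen.tracks h _⟩
  · obtain ⟨φ, hφ, hT⟩ := h.exists_tracks hν
    exact ⟨φ, hφ, by simpa using hT.compl⟩

/-- This replaces refining the topology to make f continuous: φ merges witnesses for all the sets
where a digit of f has a given value. The limit y of φ ∘ u need not be φ x. -/
theorem exists_continuity_witness (hξ : 1 ≤ ξ) (hf : f ∈ delFunctions ξ) :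
    ∃ φ, DelDigits ξ φ ∧ ∀ (u : ℕ → Baire) (x y : Baire), Tendsto u atTop (𝓝 x) →
      Tendsto (φ ∘ u) atTop (𝓝 y) → Tendsto (f ∘ u) atTop (𝓝 (f x)) := by
  choose φ hφ hT using fun n k => Del.exists_tracks (delDigits_of_mem_delFunctions hξ hf n k)
  refine ⟨mergeFun fun i => φ i.unpair.1 i.unpair.2, DelDigits.mergeFun fun i => hφ _ _, ?_⟩
  intro u x y hu hy
  refine tendsto_baire_iff.2 fun n => ?_
  have : Tracks (mergeFun fun i => φ i.unpair.1 i.unpair.2) {z | f z n = f x n} :=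
    Tracks.mergeFun (n := Nat.pair n (f x n)) (by simpa using hT n (f x n))
  filter_upwards [this u x y hu hy] with m hm
  exact hm.2 rfl

end BorelAmenable

end

section

open Set Filter Topology

namespace BorelAmenable

variable {ξ ν : Ordinal.{0}} {A B C : Set Baire} {f g : Baire → Baire} {F : Set (Baire → Baire)}
  {𝒰 : Set (Set Baire)}

/-! ### The decomposition of selfdual sets -/

/-- A sequence of pairs of functions, one preserving and one flipping membership in `A`, does not
have coherent limits along all binary sequences. -/
theorem false_of_coherent_limits (h𝒰 : IsSuitable 𝒰) (hFS : NoFlipSet 𝒰) (hA : A ∈ 𝒰)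
    (hA' : A ≠ univ) {g : ℕ → Bool → Baire → Baire} {X : (ℕ → Bool) → ℕ → Baire}
    (hX : ∀ z n, X z n = g n (z n) (X z (n + 1)))
    (hXz : ∀ z w n, (∀ i, n ≤ i → z i = w i) → X z n = X w n)
    (hmeas : Measurable fun y : Baire => X (fun i => decide (y i = 1)) 0)
    (hg0 : ∀ n x, x ∈ A ↔ g n false x ∈ A) (hg1 : ∀ n x, x ∈ A ↔ g n true x ∉ A) : False := by
  classical
  refine hFS ⟨{z | X z 0 ∈ A}, ?_, ?_⟩
  · rintro z w ⟨n, hn, huniq⟩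
    have heq : ∀ i, i ≠ n → z i = w i := fun i hi => by
      by_contra h
      exact hi (huniq i h)
    -- Beyond n the limits for z and w coincide. At n one of the two maps preserves A and the other
    -- flips it. Below n the same map acts on both sides, so the disagreement is carried down to
    -- index 0.
    have key : ∀ j m, j + m = n → (X z m ∈ A ↔ X w m ∉ A) := by
      intro j
      induction j with
      | zero =>
        rintro m rfl
        have h1 := hXz z w (0 + m + 1) fun i hi => heq i (by omega)
        rw [zero_add] at h1 hn
        rw [hX z m, hX w m, h1]
        cases hz : z m <;> cases hw : w m
        · exact absurd (hz.trans hw.symm) hn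
        · rw [← hg0, ← hg1]
        · rw [← hg0, ← not_iff_not, not_not, ← hg1]
        · exact absurd (hz.trans hw.symm) hn
      | succ j ih =>
        intro m hm
        have h1 := ih (m + 1) (by omega)
        rw [hX z m, hX w m, heq m (by omega)]
        cases w m
        · rwa [← hg0, ← hg0]
        · have h2 := hg1 m (X z (m + 1))
          have h3 := hg1 m (X w (m + 1))
          tauto
    exact key n 0 (by omega)
  · obtain ⟨b, hb⟩ := (ne_univ_iff_exists_notMem A).1 hA'
    let K : Set Baire := {y | ∀ i, y i ≤ 1}
    have hK : MeasurableSet K := by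
      have : K = ⋂ i, (fun y : Baire => y i) ⁻¹' {k | k ≤ 1} := by
        ext y
        simp [K]
      rw [this]
      exact .iInter fun i => measurable_pi_apply i (.of_discrete)
    -- Off the Cantor space the value is b ∉ A, so the preimage of A is exactly the copy of the
    -- flip-set.
    have hm : Measurable fun y : Baire => if y ∈ K then X (fun i => decide (y i = 1)) 0 else b :=
      hmeas.ite hK measurable_const
    have := h𝒰.preimage_mem A hA _ hm
    convert this using 1
    ext y
    simp only [mem_image, mem_preimage, mem_ofPred_eq]
    constructor
    · rintro ⟨z, hz, rfl⟩
      have hyK : (fun n => (z n).toNat) ∈ K := fun i => Bool.toNat_le (z i)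
      have hdec : (fun i => decide ((z i).toNat = 1)) = z := by
        funext i
        cases z i <;> rfl
      rw [if_pos hyK, hdec]
      exact hz
    · intro hy
      by_cases hyK : y ∈ K
      · rw [if_pos hyK] at hy
        refine ⟨_, hy, funext fun i => ?_⟩
        have := hyK i
        interval_cases h : y i <;> simp
      · rw [if_neg hyK] at hy
        exact absurd hy hb

/-- On the set `D`, the set `A` is patched from countably many sets that are strictly below it. -/
def IsSmall (ξ : Ordinal.{0}) (A D : Set Baire) : Prop :=
  ∃ E C : ℕ → Set Baire, (∀ n, IsSigma ξ (E n)) ∧ D ⊆ ⋃ n, E n ∧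
    (∀ n, SRed (delFunctions ξ) (C n) A) ∧ ∀ n, ∀ x ∈ E n ∩ D, (x ∈ A ↔ x ∈ C n)

theorem isSmall_of_fibers {ι : Type*} [Countable ι] {D : Set Baire} {P : Baire → ι}
    (hP : ∀ i, IsSigma ξ {x | P x = i}) (h : ∀ i, IsSmall ξ A (D ∩ {x | P x = i})) :
    IsSmall ξ A D := by
  have : Nonempty ι := ⟨P fun _ => 0⟩
  obtain ⟨c, hc⟩ := exists_surjective_nat ι
  choose E C h1 h2 h3 h4 using h
  refine ⟨fun k => E (c k.unpair.1) k.unpair.2 ∩ {x | P x = c k.unpair.1},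
    fun k => C (c k.unpair.1) k.unpair.2, fun k => (h1 _ _).inter (hP _), ?_, fun k => h3 _ _, ?_⟩
  · intro x hx
    obtain ⟨j, hj⟩ := hc (P x)
    obtain ⟨n, hn⟩ := mem_iUnion.1 (h2 (P x) ⟨hx, rfl⟩)
    refine mem_iUnion.2 ⟨Nat.pair j n, ?_⟩
    simp only [Nat.unpair_pair, hj]
    exact ⟨hn, rfl⟩
  · rintro k x ⟨⟨hx1, hx2⟩, hx3⟩
    exact h4 _ _ x ⟨hx1, hx3, hx2⟩

/-- A finite table of digits has countably many possible values, and D would be small if all the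
fibers were. -/
theorem exists_large_const {D : Set Baire} (hD : D ∈ Del ξ) (hDA : ¬ IsSmall ξ A D)
    (T : List (Baire → Baire)) (hT : ∀ h ∈ T, DelDigits ξ h) (n : ℕ) :
    ∃ E ∈ Del ξ, ¬ IsSmall ξ A E ∧ ∀ h ∈ T, ∀ x ∈ E, ∀ y ∈ E, AgreeTo n (h x) (h y) := by
  let P : Baire → (Fin T.length × Fin n → ℕ) := fun x i => T.get i.1 x i.2
  have hP : ∀ s, {x | P x = s} ∈ Del ξ := by
    intro s
    have : {x | P x = s} = ⋂ i, {x | T.get i.1 x i.2 = s i} := by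
      ext x
      simp only [mem_ofPred_eq, mem_iInter, funext_iff, P]
    rw [this]
    exact Del.iInter hD.1.one_le fun i => hT _ (T.get_mem i.1) _ _
  have : ∃ s, ¬ IsSmall ξ A (D ∩ {x | P x = s}) := by
    by_contra! h
    exact hDA (isSmall_of_fibers (fun s => (hP s).1) h)
  obtain ⟨s, hs⟩ := this
  refine ⟨_, Del.inter hD (hP s), hs, ?_⟩
  rintro h hh x ⟨-, hx⟩ y ⟨-, hy⟩ i hi
  obtain ⟨j, rfl⟩ := List.mem_iff_get.1 hh
  exact congrFun (hx.trans hy.symm) (j, ⟨i, hi⟩)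

/-- Let r be the identity on D and constant, with value in D, elsewhere. The preimage of A under r
agrees with A on D; were it strictly below A, D would be small. So some g reduces A to it, and r ∘ g
preserves A with values in D. Composing with a reduction of A to its complement gives the flipping
map. -/
theorem exists_reduction_into_large (hξ : 1 ≤ ξ) (hA : Selfdual (delFunctions ξ) A)
    {D : Set Baire} (hD : D ∈ Del ξ) (hDA : ¬ IsSmall ξ A D) :
    ∃ g : Bool → Baire → Baire, (∀ b, g b ∈ delFunctions ξ) ∧ (∀ b x, g b x ∈ D) ∧
      (∀ x, x ∈ A ↔ g false x ∈ A) ∧ ∀ x, x ∈ A ↔ g true x ∉ A := by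
  classical
  have hF := isAmenable_delFunctions hξ
  obtain ⟨f, hf, hAf⟩ := hA
  have hne : D.Nonempty := by
    by_contra h
    rw [not_nonempty_iff_eq_empty] at h
    have hA : Selfdual (delFunctions ξ) A := ⟨f, hf, hAf⟩
    refine hDA ⟨fun _ => ∅, fun _ => ∅, fun _ => .of_isOpen isOpen_empty hξ, by simp [h],
      fun _ => ⟨hF.red_empty hA.ne_univ, ?_⟩, by simp⟩
    rintro ⟨g, -, hg⟩
    exact hA.ne_empty hg
  obtain ⟨d, hd⟩ := hne
  obtain ⟨r, hr, hrD⟩ := hF.glue_cover (D := fun b : Bool => bif b then D else Dᶜ)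
    (fun b => by cases b; exacts [hD.2, hD.1])
    (fun x => (em (x ∈ D)).elim (fun h => ⟨true, h⟩) fun h => ⟨false, h⟩)
    (f := fun b => bif b then id else fun _ => d)
    (fun b => by
      cases b
      exacts [hF.lip_one_subset (const_mem_lipWith_one d), hF.lip_one_subset id_mem_lipWith_one])
  have hr1 : ∀ x ∈ D, r x = x := fun x hx => by
    obtain ⟨b, hb, h⟩ := hrD x
    cases b
    · exact absurd hx hb
    · exact h
  have hr2 : ∀ x, r x ∈ D := fun x => by
    obtain ⟨b, hb, h⟩ := hrD x
    cases b
    · rw [h]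
      exact hd
    · rw [h]
      exact hb
  have hred : Red (delFunctions ξ) A (r ⁻¹' A) := by
    by_contra h
    refine hDA ⟨fun _ => univ, fun _ => r ⁻¹' A, fun _ => .of_isOpen isOpen_univ hξ,
      fun x _ => mem_iUnion.2 ⟨0, mem_univ x⟩, fun _ => ⟨⟨r, hr, rfl⟩, h⟩, ?_⟩
    rintro - x ⟨-, hx⟩
    rw [mem_preimage, hr1 x hx]
  obtain ⟨g, hg, hAg⟩ := hred
  have hgA : ∀ x, x ∈ A ↔ r (g x) ∈ A := fun x => Set.ext_iff.1 hAg x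
  refine ⟨fun b => bif b then r ∘ g ∘ f else r ∘ g, fun b => ?_, fun b x => ?_, hgA, fun x => ?_⟩
  · cases b
    · exact hF.comp_mem _ hg _ hr
    · exact hF.comp_mem _ hf _ (hF.comp_mem _ hg _ hr)
  · cases b <;> exact hr2 _
  · exact (Set.ext_iff.1 hAf x).trans (not_congr (hgA (f x)))

/-- A large `𝚫⁰_ξ` set, together with a finite list of functions that are under control on it. -/
def LargeState (ξ : Ordinal.{0}) (A : Set Baire) : Type :=
  {S : Set Baire × List (Baire → Baire) // S.1 ∈ Del ξ ∧ ¬ IsSmall ξ A S.1 ∧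
    ∀ h ∈ S.2, DelDigits ξ h}

/-- One stage of the construction of the functions whose limits form a flip-set. -/
def IsStep (n : ℕ) (S S' : LargeState ξ A) (g : Bool → Baire → Baire) : Prop :=
  (∀ b, g b ∈ delFunctions ξ) ∧ (∀ b x, g b x ∈ S.1.1) ∧
    (∀ x, x ∈ A ↔ g false x ∈ A) ∧ (∀ x, x ∈ A ↔ g true x ∉ A) ∧ id ∈ S'.1.2 ∧
    (∀ b, ∃ φ ∈ S'.1.2, ∀ (u : ℕ → Baire) (x y : Baire), Tendsto u atTop (𝓝 x) →
      Tendsto (φ ∘ u) atTop (𝓝 y) → Tendsto (g b ∘ u) atTop (𝓝 (g b x))) ∧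
    (∀ b, ∀ h ∈ S.1.2, h ∘ g b ∈ S'.1.2) ∧
    ∀ h ∈ S'.1.2, ∀ x ∈ S'.1.1, ∀ y ∈ S'.1.1, AgreeTo (n + 1) (h x) (h y)

theorem exists_isStep (hξ : 1 ≤ ξ) (hA : Selfdual (delFunctions ξ) A) (n : ℕ)
    (S : LargeState ξ A) : ∃ S' g, IsStep n S S' g := by
  obtain ⟨g, hg, hgS, hg0, hg1⟩ := exists_reduction_into_large hξ hA S.2.1 S.2.2.1
  choose φ hφ hφg using fun b => exists_continuity_witness hξ (hg b)
  -- Control of `id` makes the points converge, control of φ b lets limits pass through g b, and the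
  -- composites h ∘ g b carry the control of the older functions h along the iteration.
  let T : List (Baire → Baire) := id :: φ false :: φ true ::
    (S.1.2.map (fun h => h ∘ g false) ++ S.1.2.map fun h => h ∘ g true)
  have hT : ∀ h ∈ T, DelDigits ξ h := by
    intro h hh
    simp only [T, List.mem_cons, List.mem_append, List.mem_map] at hh
    rcases hh with rfl | rfl | rfl | ⟨k, hk, rfl⟩ | ⟨k, hk, rfl⟩
    · exact delDigits_of_mem_delFunctions hξ (mem_delFunctions_of_continuous continuous_id)
    · exact hφ _
    · exact hφ _
    · exact (S.2.2.2 k hk).comp (hg _)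
    · exact (S.2.2.2 k hk).comp (hg _)
  obtain ⟨E, hE, hEA, hET⟩ := exists_large_const S.2.1 S.2.2.1 T hT (n + 1)
  refine ⟨⟨(E, T), hE, hEA, hT⟩, g, hg, hgS, hg0, hg1, by simp [T], fun b => ⟨φ b, ?_, hφg b⟩,
    fun b h hh => ?_, hET⟩
  · cases b <;> simp [T]
  · cases b
    · simp only [T, List.mem_cons, List.mem_append, List.mem_map]
      exact .inr (.inr (.inr (.inl ⟨h, hh, rfl⟩)))
    · simp only [T, List.mem_cons, List.mem_append, List.mem_map]
      exact .inr (.inr (.inr (.inr ⟨h, hh, rfl⟩)))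

/-- The composition of the `l` functions `g n (z n)`, …, applied to the point `p (n + l)`. -/
def iterPoint (g : ℕ → Bool → Baire → Baire) (p : ℕ → Baire) (z : ℕ → Bool) : ℕ → ℕ → Baire
  | n, 0 => p n
  | n, l + 1 => g n (z n) (iterPoint g p z (n + 1) l)

theorem iterPoint_congr {g : ℕ → Bool → Baire → Baire} {p : ℕ → Baire} {z w : ℕ → Bool} (l n : ℕ)
    (h : ∀ i, n ≤ i → z i = w i) : iterPoint g p z n l = iterPoint g p w n l := by
  induction l generalizing n with
  | zero => rfl
  | succ l ih =>
    rw [iterPoint, iterPoint, h n le_rfl, ih (n + 1) fun i hi => h i (by omega)]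

theorem measurable_iterPoint {g : ℕ → Bool → Baire → Baire} (hg : ∀ n b, Measurable (g n b))
    (p : ℕ → Baire) (l n : ℕ) :
    Measurable fun y : Baire => iterPoint g p (fun i => decide (y i = 1)) n l := by
  induction l generalizing n with
  | zero => exact measurable_const
  | succ l ih =>
    have hs : MeasurableSet {y : Baire | y n = 1} := measurable_pi_apply n (.of_discrete (s := {1}))
    have hm : Measurable fun y : Baire => if y n = 1
        then g n true (iterPoint g p (fun i => decide (y i = 1)) (n + 1) l)
        else g n false (iterPoint g p (fun i => decide (y i = 1)) (n + 1) l) :=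
      ((hg n true).comp (ih (n + 1))).ite hs ((hg n false).comp (ih (n + 1)))
    convert hm using 2 with y
    by_cases h : y n = 1 <;> simp [iterPoint, h]

/-- If the whole space is large the stages never stop, and the limits X z n of the iterated points
satisfy X z n = G n (z n) (X z (n + 1)). This is what produces a flip-set. -/
theorem isSmall_univ (h𝒰 : IsSuitable 𝒰) (hFS : NoFlipSet 𝒰) (hξ : 1 ≤ ξ) (hA𝒰 : A ∈ 𝒰)
    (hA : Selfdual (delFunctions ξ) A) : IsSmall ξ A univ := by
  by_contra hlarge
  choose next g hstep using exists_isStep hξ hA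
  let S0 : LargeState ξ A := ⟨(univ, [id]), IsClopen.mem_del isClopen_univ hξ, hlarge, by
    simpa using delDigits_of_mem_delFunctions hξ (mem_delFunctions_of_continuous continuous_id)⟩
  let S : ℕ → LargeState ξ A := fun n => Nat.rec S0 next n
  let G : ℕ → Bool → Baire → Baire := fun n => g n (S n)
  have hS : ∀ n, IsStep n (S n) (S (n + 1)) (G n) := fun n => hstep n (S n)
  have hid : ∀ n, id ∈ (S n).1.2 := by
    intro n
    cases n with
    | zero => exact List.mem_singleton.2 rfl
    | succ n => exact (hS n).2.2.2.2.1
  have hagree : ∀ n, ∀ h ∈ (S n).1.2, ∀ x ∈ (S n).1.1, ∀ y ∈ (S n).1.1,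
      AgreeTo n (h x) (h y) := by
    intro n
    cases n with
    | zero => intro _ _ _ _ _ _ i hi; omega
    | succ n => exact (hS n).2.2.2.2.2.2.2
  have hne : ∀ n, ((S n).1.1).Nonempty := fun n => ⟨_, (hS n).2.1 true fun _ => 0⟩
  choose p hp using hne
  have hmem : ∀ z n l, iterPoint G p z n l ∈ (S n).1.1 := by
    intro z n l
    cases l with
    | zero => exact hp n
    | succ l => exact (hS n).2.1 _ _
  -- The composite of h with l successive maps is listed at stage n + l, so on the large set of that
  -- stage its first n + l digits are constant.
  have hstab : ∀ z l l' n, l ≤ l' → ∀ h ∈ (S n).1.2,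
      AgreeTo (n + l) (h (iterPoint G p z n l)) (h (iterPoint G p z n l')) := by
    intro z l
    induction l with
    | zero =>
      intro l' n _ h hh
      exact hagree n h hh _ (hmem _ _ _) _ (hmem _ _ _)
    | succ l ih =>
      intro l' n hl h hh
      obtain ⟨k, rfl⟩ : ∃ k, l' = k + 1 := ⟨l' - 1, by omega⟩
      have := ih k (n + 1) (by omega) _ ((hS n).2.2.2.2.2.2.1 (z n) h hh)
      rwa [show n + (l + 1) = n + 1 + l by omega]
  have hlim : ∀ z n, ∀ h ∈ (S n).1.2, Tendsto (fun l => h (iterPoint G p z n l)) atTop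
      (𝓝 fun k => h (iterPoint G p z n (k + 1)) k) := by
    intro z n h hh
    refine tendsto_baire_iff.2 fun k => ?_
    filter_upwards [eventually_ge_atTop (k + 1)] with l hl
    exact (hstab z (k + 1) l n hl h hh k (by omega)).symm
  let X : (ℕ → Bool) → ℕ → Baire := fun z n k => iterPoint G p z n (k + 1) k
  have hX : ∀ z n, Tendsto (fun l => iterPoint G p z n l) atTop (𝓝 (X z n)) := fun z n =>
    hlim z n id (hid n)
  refine false_of_coherent_limits h𝒰 hFS hA𝒰 hA.ne_univ (g := G) (X := X) ?_ ?_ ?_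
    (fun n => (hS n).2.2.1) fun n => (hS n).2.2.2.1
  · intro z n
    obtain ⟨φ, hφ, hc⟩ := (hS n).2.2.2.2.2.1 (z n)
    -- The witness φ of G n (z n) is listed at stage n + 1, so it converges along the iterated
    -- points starting there.
    have h1 := hc _ _ _ (hX z (n + 1)) (hlim z (n + 1) φ hφ)
    exact tendsto_nhds_unique ((tendsto_add_atTop_iff_nat 1).2 (hX z n)) h1
  · intro z w n h
    funext k
    exact congrFun (iterPoint_congr (k + 1) n h) k
  · refine measurable_pi_iff.2 fun k => ?_
    have hm := measurable_iterPoint (g := G)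
      (fun n b => measurable_of_mem_delFunctions hξ ((hS n).1 b)) p (k + 1) 0
    exact (measurable_pi_apply k).comp hm

/-- A selfdual set is patched, along a countable `𝚺⁰_ξ` cover, from sets strictly below it. -/
theorem exists_decomposition (h𝒰 : IsSuitable 𝒰) (hFS : NoFlipSet 𝒰) (hξ : 1 ≤ ξ) (hA𝒰 : A ∈ 𝒰)
    (hA : Selfdual (delFunctions ξ) A) : ∃ E C : ℕ → Set Baire, (∀ n, IsSigma ξ (E n)) ∧
      Pairwise (fun m n => Disjoint (E m) (E n)) ∧ (∀ x, ∃ n, x ∈ E n) ∧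
      (∀ n, SRed (delFunctions ξ) (C n) A) ∧ ∀ n, ∀ x ∈ E n, (x ∈ A ↔ x ∈ C n) := by
  obtain ⟨D, C, h1, h2, h3, h4⟩ := isSmall_univ h𝒰 hFS hξ hA𝒰 hA
  obtain ⟨E, hE, hED, hdisj, hu⟩ := exists_reduction h1
  refine ⟨E, C, hE, hdisj, fun x => ?_, h3, fun n x hx => h4 n x ⟨hED n hx, mem_univ x⟩⟩
  exact mem_iUnion.1 (hu.symm ▸ h2 (mem_univ x))

/-! ### Reducibility depends only on the characteristic set -/

/-- For nonselfdual C, SLO already yields a Lipschitz reduction. For selfdual C, the decomposition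
is pulled back along the given reduction; SLO makes each piece Lipschitz reducible to the complement
of C, and F glues. Using this for B and for C itself removes the complement. -/
theorem IsAmenable.red_iff_delFunctions (hF : IsAmenable F ξ) (h𝒰 : IsSuitable 𝒰)
    (hSLO : SLOL 𝒰) (hFS : NoFlipSet 𝒰) (hC : C ∈ 𝒰) :
    Red F B C ↔ Red (delFunctions ξ) B C := by
  have hM := isAmenable_delFunctions hF.one_le
  refine ⟨fun h => h.mono hF.subset_delFunctions, fun hBC => ?_⟩
  by_cases hsd : Selfdual (delFunctions ξ) C
  · obtain ⟨E, D, hE, -, hu, hD, hCD⟩ := exists_decomposition h𝒰 hFS hF.one_le hC hsd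
    have key : ∀ B, Red (delFunctions ξ) B C → Red F B Cᶜ := by
      rintro _ ⟨h, hh, rfl⟩
      refine hF.red_of_cover (D := fun n => h ⁻¹' E n) (C := fun n => h ⁻¹' D n)
        (fun n => (hE n).preimage_of_mem_delFunctions hh) (fun x => hu (h x)) (fun n => ?_)
        fun n x hx => hCD n (h x) hx
      have h1 : SRed (delFunctions ξ) (h ⁻¹' D n) C := hM.sred_of_red ⟨h, hh, rfl⟩ (hD n)
      rcases hSLO C hC _ (hM.mem_of_red h𝒰 hC h1.1) with h2 | h2
      · exact absurd (hM.red_of_lip h2) h1.2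
      · exact hF.red_of_lip (red_compl_comm.2 h2)
    exact hF.red_trans (key B hBC) (red_compl_comm.1 (key C (hM.red_refl C)))
  · rcases hSLO B (hM.mem_of_red h𝒰 hC hBC) C hC with h | h
    · exact hF.red_of_lip h
    · exact absurd (red_compl_comm.2 (hM.red_trans (hM.red_of_lip h) hBC)) hsd

end BorelAmenable

end

section

open Set Filter Topology

namespace BorelAmenable

variable {ξ ν : Ordinal.{0}} {A B C : Set Baire} {f g : Baire → Baire} {F : Set (Baire → Baire)}
  {𝒰 : Set (Set Baire)}

/-! ### Complete sets for the Borel classes -/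

theorem countable_Iio_of_lt_omega_one {α : Ordinal.{0}} (hα : α < ω₁) : Countable (Iio α) := by
  rw [← Cardinal.mk_le_aleph0_iff, Cardinal.mk_Iio_ordinal, ← Cardinal.lift_aleph0.{1, 0},
    Cardinal.lift_le, ← Cardinal.lt_aleph_one_iff, ← Cardinal.lt_ord, Cardinal.ord_aleph]
  exact hα

/-- There are countably many levels below ξ, and each gets infinitely many columns carrying a
complete set of that level. Column `Nat.pair i j` is used for the j-th piece if level i is the level
of that piece; otherwise it is parked at a point of T, where it contributes nothing. -/
theorem exists_lipComplete_isSigma (hξ : 1 ≤ ξ) (hξ' : ξ < ω₁) :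
    ∃ T, IsSigma ξ T ∧ ∀ B, IsSigma ξ B → Red (LipWith 1) B T := by
  classical
  induction ξ using WellFoundedLT.induction with
  | ind ξ ih =>
  rcases hξ.eq_or_lt with rfl | hlt
  · refine ⟨{x | ∃ n, x n = 0}, .isOpen _ ?_, fun B hB => ?_⟩
    · have : {x : Baire | ∃ n, x n = 0} = ⋃ n, (fun x : Baire => x n) ⁻¹' {0} := by
        ext x
        simp
      rw [this]
      exact isOpen_iUnion fun n => (isOpen_discrete _).preimage (continuous_apply n)
    · refine ⟨fun x n => if ∀ y, AgreeTo (n + 1) x y → y ∈ B then 0 else 1, ?_, ?_⟩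
      · refine mem_lipWith_one_iff.2 fun n x y hxy i hi => ?_
        have : (∀ z, AgreeTo (i + 1) x z → z ∈ B) ↔ ∀ z, AgreeTo (i + 1) y z → z ∈ B := by
          constructor <;> intro h z hz <;> apply h <;> intro j hj
          · rw [hxy j (by omega), hz j hj]
          · rw [← hxy j (by omega), hz j hj]
        simp only [this]
      · ext x
        simp only [mem_preimage, mem_ofPred_eq, ite_eq_left_iff, one_ne_zero, imp_false, not_not]
        constructor
        · intro hx
          obtain ⟨n, hn⟩ := exists_agreeTo_subset (isSigma_one_iff.1 hB) hx
          exact ⟨n, fun y hy => hn y fun i hi => hy i (by omega)⟩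
        · rintro ⟨n, hn⟩
          exact hn x fun _ _ => rfl
  · let ι := {μ : Ordinal.{0} // 1 ≤ μ ∧ μ < ξ}
    have : Countable ι := by
      have := countable_Iio_of_lt_omega_one hξ'
      exact Function.Injective.countable (β := Iio ξ) (f := fun i : ι => ⟨i.1, i.2.2⟩)
        fun i j h => Subtype.ext (congrArg (fun k : Iio ξ => k.1) h)
    have : Nonempty ι := ⟨⟨1, le_rfl, hlt⟩⟩
    obtain ⟨c, hc⟩ := exists_surjective_nat ι
    choose T hT hTc using fun i : ι => ih i.1 i.2.2 i.2.1 (i.2.2.trans hξ')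
    have hne : ∀ i, ∃ q, q ∈ T i := by
      intro i
      obtain ⟨f, -, hf⟩ := hTc i univ (.of_isOpen isOpen_univ i.2.1)
      exact ⟨_, (Set.ext_iff.1 hf fun _ => 0).1 (mem_univ _)⟩
    choose q hq using hne
    refine ⟨⋃ n, proj Nat.pairEquiv n ⁻¹' (T (c n.unpair.1))ᶜ, ?_, fun B hB => ?_⟩
    · refine .iUnion ξ (fun n => c n.unpair.1) _ hlt (fun n => (c _).2) fun n => ?_
      rw [preimage_compl, compl_compl]
      exact (hT _).preimage (continuous_proj _ _)
    · obtain ⟨μ, D, hμ, hD, rfl⟩ := (isSigma_iff hlt).1 hB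
      have : ∀ n : ℕ, ∃ h ∈ LipWith 1,
          ((c n.unpair.1).1 = μ n.unpair.2 → D n.unpair.2 = h ⁻¹' (T (c n.unpair.1))ᶜ) ∧
          ((c n.unpair.1).1 ≠ μ n.unpair.2 → ∀ x, h x ∈ T (c n.unpair.1)) := by
        intro n
        by_cases h : (c n.unpair.1).1 = μ n.unpair.2
        · obtain ⟨k, hk, hDk⟩ := hTc (c n.unpair.1) _ (h ▸ hD n.unpair.2)
          refine ⟨k, hk, fun _ => ?_, fun h' => absurd h h'⟩
          rw [preimage_compl, ← hDk, compl_compl]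
        · exact ⟨_, const_mem_lipWith_one (q _), fun h' => absurd h' h, fun _ _ => hq _⟩
      choose h hh h1 h2 using this
      refine ⟨_, merge_mem_lipWith_one hh, ?_⟩
      ext x
      simp only [mem_preimage, mem_iUnion, proj_merge]
      constructor
      · rintro ⟨j, hj⟩
        obtain ⟨i, hi⟩ := hc ⟨μ j, hμ j⟩
        refine ⟨Nat.pair i j, ?_⟩
        have := h1 (Nat.pair i j) (by simp [hi])
        rw [← mem_preimage, ← this]
        simpa using hj
      · rintro ⟨n, hn⟩
        refine ⟨n.unpair.2, ?_⟩
        by_cases hc' : (c n.unpair.1).1 = μ n.unpair.2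
        · rw [h1 n hc']
          exact hn
        · exact absurd (h2 n hc' x) hn

/-! ### The successor pointclass -/

/-- The standing assumptions: the localized axioms, and a level of the Borel hierarchy. -/
structure IsDetermined (𝒰 : Set (Set Baire)) (ξ : Ordinal.{0}) : Prop where
  suitable : IsSuitable 𝒰
  slo : SLOL 𝒰
  noFlipSet : NoFlipSet 𝒰
  one_le : 1 ≤ ξ
  lt_omega_one : ξ < ω₁

/-- Disjoint 𝚺⁰_ξ pieces do as well, since they split into disjoint 𝚷⁰_{<ξ} sets. This is what
closes Γ⁺(A) under F, whose preimages of 𝚷⁰_{<ξ} sets are only known to be 𝚫⁰_ξ. -/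
theorem mem_gammaPlus_of_isSigma {ι : Type*} (e : ι ≃ ℕ) {D C : ι → Set Baire}
    (hD : ∀ i, IsSigma ξ (D i)) (hdisj : Pairwise (fun i j => Disjoint (D i) (D j)))
    (hC : ∀ i, SRed F (C i) A) (hB : B = ⋃ i, D i ∩ C i) : B ∈ GammaPlus F ξ A := by
  choose G hG hGd hDG using fun i => (hD i).exists_disjoint_piLT
  refine ⟨fun n => G (e.symm n.unpair.1) n.unpair.2, fun n => C (e.symm n.unpair.1),
    fun n => hG _ _, fun m n hmn => ?_, fun n => hC _, ?_⟩
  · refine Set.disjoint_left.2 fun x hx hx' => ?_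
    by_cases h : m.unpair.1 = n.unpair.1
    · have h2 : m.unpair.2 ≠ n.unpair.2 := fun h2 => hmn (by
        rw [← Nat.pair_unpair m, ← Nat.pair_unpair n, h, h2])
      change x ∈ G (e.symm m.unpair.1) _ at hx
      rw [h] at hx
      exact Set.disjoint_left.1 (hGd _ h2) hx hx'
    · have hGD : ∀ i k, G i k ⊆ D i := fun i k => by
        rw [hDG]
        exact subset_iUnion _ k
      exact Set.disjoint_left.1 (hdisj fun h' => h (e.symm.injective h')) (hGD _ _ hx) (hGD _ _ hx')
  · rw [hB]
    ext x
    simp only [mem_iUnion, mem_inter_iff]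
    constructor
    · rintro ⟨i, hi, hiC⟩
      rw [hDG] at hi
      obtain ⟨k, hk⟩ := mem_iUnion.1 hi
      exact ⟨Nat.pair (e i) k, by simpa using ⟨hk, hiC⟩⟩
    · rintro ⟨n, hn, hnC⟩
      refine ⟨_, ?_, hnC⟩
      rw [hDG]
      exact mem_iUnion_of_mem _ hn

theorem preimage_mem_gammaPlus (hF : IsAmenable F ξ) (hf : f ∈ F) (hB : B ∈ GammaPlus F ξ A) :
    f ⁻¹' B ∈ GammaPlus F ξ A := by
  obtain ⟨D, C, hD, hdisj, hC, rfl⟩ := hB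
  refine mem_gammaPlus_of_isSigma (Equiv.refl ℕ) (D := fun n => f ⁻¹' D n)
    (C := fun n => f ⁻¹' C n) (fun n => ?_) (fun m n hmn => (hdisj hmn).preimage f)
    (fun n => hF.sred_of_red ⟨f, hf, rfl⟩ (hC n)) ?_
  · exact (hF.subset_delFunctions hf _ (PiLT.mem_del (hD n))).1
  · simp [preimage_iUnion]

/-- The pieces for B and those for its complement together cover the space. On each, B agrees with a
set strictly below A or with the complement of one, which is below A too by selfduality. -/
theorem red_of_mem_gammaPlus (hF : IsAmenable F ξ) (hB : B ∈ GammaPlus F ξ A)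
    (hB' : Bᶜ ∈ GammaPlus F ξ A) (hA : Selfdual F A) : Red F B A := by
  have key : ∀ {B : Set Baire} {D C : ℕ → Set Baire},
      Pairwise (fun m n => Disjoint (D m) (D n)) → B = ⋃ n, D n ∩ C n →
      ∀ n, ∀ x ∈ D n, (x ∈ B ↔ x ∈ C n) := by
    rintro B D C hdisj rfl n x hx
    simp only [mem_iUnion, mem_inter_iff]
    refine ⟨?_, fun h => ⟨n, hx, h⟩⟩
    rintro ⟨m, hm, hmC⟩
    by_cases h : m = n
    · exact h ▸ hmC
    · exact absurd hx (Set.disjoint_left.1 (hdisj h) hm)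
  obtain ⟨D, C, hD, hdisj, hC, hBD⟩ := hB
  obtain ⟨D', C', hD', hdisj', hC', hBD'⟩ := hB'
  refine hF.red_of_cover (D := Sum.elim D D') (C := Sum.elim C fun n => (C' n)ᶜ) ?_ ?_ ?_ ?_
  · rintro (n | n)
    · exact (PiLT.mem_del (hD n)).1
    · exact (PiLT.mem_del (hD' n)).1
  · intro x
    by_cases hx : x ∈ B
    · rw [hBD] at hx
      obtain ⟨n, hn⟩ := mem_iUnion.1 hx
      exact ⟨.inl n, hn.1⟩
    · rw [← mem_compl_iff, hBD'] at hx
      obtain ⟨n, hn⟩ := mem_iUnion.1 hx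
      exact ⟨.inr n, hn.1⟩
  · rintro (n | n)
    · exact (hC n).1
    · exact (hF.sred_compl_of_selfdual hA (hC' n)).1
  · rintro (n | n) x hx
    · exact key hdisj hBD n x hx
    · have := key hdisj' hBD' n x hx
      rw [mem_compl_iff] at this
      exact not_iff_comm.1 this |>.symm.trans Iff.rfl

namespace IsDetermined

theorem amenable (h : IsDetermined 𝒰 ξ) : IsAmenable (delFunctions ξ) ξ :=
  isAmenable_delFunctions h.one_le

/-- Patching preimages of a selfdual set `A` along disjoint `𝚺⁰_ξ` sets gives a set in `Γ⁺(A)`. -/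
theorem patch_mem_gammaPlus (h : IsDetermined 𝒰 ξ) (hA𝒰 : A ∈ 𝒰)
    (hA : Selfdual (delFunctions ξ) A) {U : ℕ → Set Baire} (hU : ∀ n, IsSigma ξ (U n))
    (hdisj : Pairwise (fun m n => Disjoint (U m) (U n))) {k : ℕ → Baire → Baire}
    (hk : ∀ n, k n ∈ delFunctions ξ) :
    {x | ∃ n, x ∈ U n ∧ k n x ∈ A} ∈ GammaPlus (delFunctions ξ) ξ A := by
  obtain ⟨E, C, hE, hEd, hEu, hC, hAC⟩ :=
    exists_decomposition h.suitable h.noFlipSet h.one_le hA𝒰 hA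
  refine mem_gammaPlus_of_isSigma Nat.pairEquiv (D := fun i => U i.1 ∩ k i.1 ⁻¹' E i.2)
    (C := fun i => k i.1 ⁻¹' C i.2)
    (fun i => (hU _).inter ((hE _).preimage_of_mem_delFunctions (hk _))) ?_
    (fun i => h.amenable.sred_of_red ⟨_, hk _, rfl⟩ (hC _)) ?_
  · rintro ⟨m, i⟩ ⟨n, j⟩ hne
    refine Set.disjoint_left.2 ?_
    rintro x ⟨hx, hx1⟩ ⟨hx', hx1'⟩
    by_cases hmn : m = n
    · subst hmn
      exact Set.disjoint_left.1 (hEd fun hij => hne (congrArg (Prod.mk m) hij)) hx1 hx1'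
    · exact Set.disjoint_left.1 (hdisj hmn) hx hx'
  · ext x
    simp only [mem_ofPred_eq, mem_iUnion, mem_inter_iff, mem_preimage, Prod.exists]
    constructor
    · rintro ⟨n, hn, hx⟩
      obtain ⟨i, hi⟩ := hEu (k n x)
      exact ⟨n, i, ⟨hn, hi⟩, (hAC i _ hi).1 hx⟩
    · rintro ⟨n, i, ⟨hn, hi⟩, hx⟩
      exact ⟨n, hn, (hAC i _ hi).2 hx⟩

theorem self_mem_gammaPlus (h : IsDetermined 𝒰 ξ) (hA𝒰 : A ∈ 𝒰)
    (hA : Selfdual (delFunctions ξ) A) : A ∈ GammaPlus (delFunctions ξ) ξ A := by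
  have := h.patch_mem_gammaPlus hA𝒰 hA (U := fun n => {_x | n = 0}) (k := fun _ => id)
    (fun n => .of_isOpen isOpen_const h.one_le) (fun m n hmn => ?_)
    fun _ => mem_delFunctions_of_continuous continuous_id
  · simpa using this
  · refine Set.disjoint_left.2 fun x hx hx' => hmn ?_
    rw [mem_ofPred_eq] at hx hx'
    rw [hx, hx']

/-- The other alternative of SLO would give A ≤ Aᶜ ≤ C. Completeness in the continuous and Lipschitz
senses rests on this upgrade. -/
theorem lipRed_of_sred (h : IsDetermined 𝒰 ξ) (hA𝒰 : A ∈ 𝒰) (hA : Selfdual (delFunctions ξ) A)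
    (hC : SRed (delFunctions ξ) C A) : Red (LipWith 1) C A := by
  rcases h.slo C (h.amenable.mem_of_red h.suitable hA𝒰 hC.1) A hA𝒰 with h1 | h1
  · exact h1
  · exact absurd (h.amenable.red_trans hA (h.amenable.red_of_lip h1)) hC.2

/-- Even columns are tested against a complete 𝚺⁰_ξ set, reduced to disjoint sets U n, and odd
columns against A. -/
theorem exists_lipComplete_gammaPlus (h : IsDetermined 𝒰 ξ) (hA𝒰 : A ∈ 𝒰)
    (hA : Selfdual (delFunctions ξ) A) : ∃ S ∈ GammaPlus (delFunctions ξ) ξ A,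
      ∀ B ∈ GammaPlus (delFunctions ξ) ξ A, Red (LipWith 1) B S := by
  obtain ⟨T, hT, hTc⟩ := exists_lipComplete_isSigma h.one_le h.lt_omega_one
  have hproj : ∀ n, Continuous (proj Nat.pairEquiv n) := fun n => continuous_proj _ n
  obtain ⟨U, hU, hUT, hUd, hUu⟩ := exists_reduction
    fun n => hT.preimage (hproj (2 * n))
  refine ⟨_, h.patch_mem_gammaPlus hA𝒰 hA hU hUd (k := fun n => proj Nat.pairEquiv (2 * n + 1))
    fun n => mem_delFunctions_of_continuous (hproj _), ?_⟩
  rintro B ⟨D, C, hD, hdisj, hC, rfl⟩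
  choose f hf hDf using fun n => hTc _ (PiLT.mem_del (hD n)).1
  choose g hg hCg using fun n => h.lipRed_of_sred hA𝒰 hA (hC n)
  let k : ℕ → Baire → Baire := fun n => if n % 2 = 0 then f (n / 2) else g (n / 2)
  have hk : ∀ n, k n ∈ LipWith 1 := by
    intro n
    by_cases hn : n % 2 = 0 <;> simp only [k, hn, if_true, if_false]
    exacts [hf _, hg _]
  have hk0 : ∀ n, k (2 * n) = f n := fun n => by simp [k]
  have hk1 : ∀ n, k (2 * n + 1) = g n := fun n => by
    have h2 : (2 * n + 1) / 2 = n := by omega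
    simp [k, h2]
  refine ⟨_, merge_mem_lipWith_one hk, ?_⟩
  ext x
  simp only [mem_iUnion, mem_inter_iff, mem_preimage, mem_ofPred_eq, proj_merge, hk1]
  have hxD : ∀ n, x ∈ D n ↔ (fun i => k i.unpair.1 x i.unpair.2) ∈
      proj Nat.pairEquiv (2 * n) ⁻¹' T := fun n => by
    rw [mem_preimage, proj_merge, hk0, hDf n, mem_preimage]
  -- The D n are disjoint already, so passing to the reduced sets U n loses nothing at the image of
  -- x.
  have hxU : ∀ n, x ∈ D n ↔ (fun i => k i.unpair.1 x i.unpair.2) ∈ U n := by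
    intro n
    constructor
    · intro hx
      have h1 := mem_iUnion_of_mem (s := fun n => proj Nat.pairEquiv (2 * n) ⁻¹' T) n ((hxD n).1 hx)
      rw [← hUu] at h1
      obtain ⟨m, hm⟩ := mem_iUnion.1 h1
      have h2 := (hxD m).2 (hUT m hm)
      by_cases hmn : m = n
      · exact hmn ▸ hm
      · exact absurd hx (Set.disjoint_left.1 (hdisj hmn) h2)
    · intro hx
      exact (hxD n).2 (hUT n hx)
  refine exists_congr fun n => ?_
  rw [← hxU n, hCg n, mem_preimage]

theorem gammaPlus_preimage_continuous (h : IsDetermined 𝒰 ξ) (hf : Continuous f)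
    (hB : B ∈ GammaPlus (delFunctions ξ) ξ A) : f ⁻¹' B ∈ GammaPlus (delFunctions ξ) ξ A :=
  preimage_mem_gammaPlus h.amenable (mem_delFunctions_of_continuous hf) hB

theorem compl_notMem_gammaPlus (h : IsDetermined 𝒰 ξ) (hA𝒰 : A ∈ 𝒰)
    (hA : Selfdual (delFunctions ξ) A)
    (hC : ∀ B ∈ GammaPlus (delFunctions ξ) ξ A, Red W B C) :
    Cᶜ ∉ GammaPlus (delFunctions ξ) ξ A := by
  intro hC'
  obtain ⟨S, hS, hSc⟩ := h.exists_lipComplete_gammaPlus hA𝒰 hA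
  refine compl_notMem_of_lipComplete (fun B hB f hf => h.gammaPlus_preimage_continuous hf hB) hSc ?_
  obtain ⟨f, hf, hSf⟩ := (hC S hS).compl
  rw [hSf]
  exact h.gammaPlus_preimage_continuous hf hC'

/-- A member is a Borel preimage of A: use the reduction of C n on D n, and a constant b ∉ A off all
the pieces. -/
theorem gammaPlus_subset (h : IsDetermined 𝒰 ξ) (hA𝒰 : A ∈ 𝒰)
    (hA : Selfdual (delFunctions ξ) A) : GammaPlus (delFunctions ξ) ξ A ⊆ 𝒰 := by
  classical
  rintro B ⟨D, C, hD, hdisj, hC, rfl⟩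
  obtain ⟨b, hb⟩ := (ne_univ_iff_exists_notMem A).1 hA.ne_univ
  choose f hf hCf using fun n => (hC n).1
  have hDm : ∀ n, MeasurableSet (D n) := fun n => (PiLT.mem_del (hD n)).1.measurableSet
  let E : Option ℕ → Set Baire := fun o => o.elim (⋃ n, D n)ᶜ D
  let k : Option ℕ → Baire → Baire := fun o => o.elim (fun _ => b) f
  have hu : ∀ x, ∃ o, x ∈ E o := fun x => by
    by_cases hx : x ∈ ⋃ n, D n
    · obtain ⟨n, hn⟩ := mem_iUnion.1 hx
      exact ⟨some n, hn⟩
    · exact ⟨none, hx⟩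
  choose o ho using hu
  have hox : ∀ i, ∀ x ∈ E i, o x = i := by
    intro i x hx
    have h1 := ho x
    rcases i with _ | n <;> rcases h2 : o x with _ | m <;> rw [h2] at h1
    · exact absurd (mem_iUnion_of_mem m h1) hx
    · exact absurd (mem_iUnion_of_mem n hx) h1
    · by_cases hmn : m = n
      · rw [hmn]
      · exact absurd hx (Set.disjoint_left.1 (hdisj hmn) h1)
  have hk : Measurable fun x => k (o x) x := by
    intro s hs
    have : (fun x => k (o x) x) ⁻¹' s = ⋃ i, E i ∩ k i ⁻¹' s := by
      ext x
      simp only [mem_preimage, mem_iUnion, mem_inter_iff]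
      constructor
      · intro hx
        exact ⟨o x, ho x, hx⟩
      · rintro ⟨i, hi, hx⟩
        rwa [hox i x hi]
    rw [this]
    refine .iUnion fun i => ?_
    cases i with
    | none => exact (MeasurableSet.iUnion hDm).compl.inter (measurable_const hs)
    | some n => exact (hDm n).inter (measurable_of_mem_delFunctions h.one_le (hf n) hs)
  convert h.suitable.preimage_mem A hA𝒰 _ hk using 1
  ext x
  simp only [mem_iUnion, mem_inter_iff, mem_preimage]
  constructor
  · rintro ⟨n, hn, hx⟩
    rw [hox (some n) x hn]
    rw [hCf n] at hx
    exact hx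
  · intro hx
    have h1 := ho x
    rcases h2 : o x with _ | n <;> rw [h2] at h1 hx
    · exact absurd hx hb
    · exact ⟨n, h1, by rw [hCf n]; exact hx⟩

end IsDetermined

end BorelAmenable

end

section

open Set Filter Topology

namespace BorelAmenable

variable {ξ ν : Ordinal.{0}} {A B C S T : Set Baire} {f g : Baire → Baire}
  {F : Set (Baire → Baire)} {𝒰 Λ : Set (Set Baire)} {e : ℕ × ℕ ≃ ℕ} {μ : ℕ → Ordinal.{0}}
  {P : ℕ → Set Baire}

/-! ### Nonselfdual pointclasses -/

theorem dual_dual (Λ : Set (Set Baire)) : dual (dual Λ) = Λ := by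
  ext B
  simp [dual]

theorem IsNonselfdualPointclass.dual (h : IsNonselfdualPointclass F Λ) :
    IsNonselfdualPointclass F (dual Λ) := by
  obtain ⟨⟨⟨B, hB⟩, hΛ⟩, hne⟩ := h
  refine ⟨⟨⟨Bᶜ, by simpa [BorelAmenable.dual] using hB⟩, fun B hB f hf => hΛ _ hB f hf⟩, ?_⟩
  rw [dual_dual]
  exact hne.symm

theorem dual_subset (h𝒰 : IsSuitable 𝒰) (h : Λ ⊆ 𝒰) : dual Λ ⊆ 𝒰 := fun B hB => by
  simpa using h𝒰.compl_mem _ (h hB)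

/-- A nonselfdual pointclass is the lower cone of one of its sets. -/
theorem IsNonselfdualPointclass.exists_generator (h : IsNonselfdualPointclass F Λ)
    (hF : LipWith 1 ⊆ F) (hSLO : SLOL 𝒰) (hΛ : Λ ⊆ 𝒰) :
    ∃ B ∈ Λ, Bᶜ ∉ Λ ∧ (∀ C ∈ Λ, Red (LipWith 1) C B) ∧
      ∀ C ∈ 𝒰, C ∉ Λ → Red (LipWith 1) Bᶜ C := by
  obtain ⟨⟨-, hcl⟩, hne⟩ := h
  have hcl' : ∀ B ∈ Λ, ∀ C, Red (LipWith 1) C B → C ∈ Λ := by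
    rintro B hB _ ⟨f, hf, rfl⟩
    exact hcl B hB f (hF hf)
  have : ∃ B ∈ Λ, Bᶜ ∉ Λ := by
    by_contra! h
    refine hne (Subset.antisymm (fun B hB => ?_) fun B hB => h B hB)
    simpa using h _ hB
  obtain ⟨B, hB, hB'⟩ := this
  refine ⟨B, hB, hB', fun C hC => ?_, fun C hC hC' => ?_⟩
  · exact (hSLO C (hΛ hC) B (hΛ hB)).resolve_right fun h => hB' (hcl' C hC _ h)
  · exact (hSLO C hC B (hΛ hB)).resolve_left fun h => hC' (hcl' B hB _ h)

/-! ### The sets `Σ^ξ(A)` and `Π^ξ(A)` -/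

theorem piSet_eq : PiSet e P A = (SigmaSet e P Aᶜ)ᶜ := by
  classical
  ext x
  by_cases hx : ∃ n, proj e (2 * n) x ∈ P n
  · have huniq : ∀ n, proj e (2 * n) x ∈ P n → (∀ i < n, proj e (2 * i) x ∉ P i) →
        n = Nat.find hx := fun n h1 h2 => ((Nat.find_eq_iff hx).2 ⟨h1, h2⟩).symm
    have key : ∀ A, x ∈ SigmaSet e P A ↔ proj e (2 * Nat.find hx + 1) x ∈ A := by
      intro A
      constructor
      · rintro ⟨n, h1, h2, h3⟩
        rwa [← huniq n h1 h2]
      · intro h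
        exact ⟨_, Nat.find_spec hx, fun i hi => Nat.find_min hx hi, h⟩
    rw [PiSet, mem_union, mem_compl_iff, key, key]
    simp only [mem_ofPred_eq, mem_compl_iff, not_not]
    exact or_iff_left fun h => h _ (Nat.find_spec hx)
  · push Not at hx
    refine iff_of_true (.inr hx) ?_
    rintro ⟨n, h, -⟩
    exact hx n h

theorem exists_continuous_separation (hA : IsClopen A) (hB : B ≠ ∅) (hB' : B ≠ univ) :
    Red W A B := by
  classical
  obtain ⟨p, hp⟩ := nonempty_iff_ne_empty.2 hB
  obtain ⟨q, hq⟩ := (ne_univ_iff_exists_notMem B).1 hB'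
  refine ⟨fun x => if x ∈ A then p else q, ?_, ?_⟩
  · refine Continuous.if (fun x hx => ?_) continuous_const continuous_const
    rw [ofPred_mem_eq, hA.frontier_eq] at hx
    exact absurd hx (notMem_empty x)
  · ext x
    by_cases hx : x ∈ A <;> simp [hx, hp, hq]

theorem gammaPlus_compl (hF : IsAmenable F ξ) (hA : Selfdual F A) :
    GammaPlus F ξ Aᶜ = GammaPlus F ξ A := by
  have : ∀ C, SRed F C Aᶜ ↔ SRed F C A := fun C =>
    ⟨fun h => ⟨hF.red_trans h.1 hA.compl_red, fun h' => h.2 (hF.red_trans hA.compl_red h')⟩,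
      fun h => ⟨hF.red_trans h.1 hA, fun h' => h.2 (hF.red_trans hA h')⟩⟩
  simp only [GammaPlus, this]

theorem Selfdual.compl (hA : Selfdual F A) : Selfdual F Aᶜ := Red.compl hA

namespace IsDetermined

/-- By SLO, failure would reduce P n to the complement of A and make it 𝚺⁰_{μ n}. At level 0 a
clopen set reduces to any nontrivial set. -/
theorem red_auxData (h : IsDetermined 𝒰 ξ) (hP : IsAuxData ξ μ P) {n : ℕ} (hA : A ∈ PiC ν)
    (hν : ν ≤ μ n) : Red W A (P n) := by
  have hA := PiC.mono hA hν
  have hmeas : ∀ {B}, B ∈ PiC (μ n) → B ∈ 𝒰 := fun hB =>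
    h.suitable.borel_mem _ (PiC.mem_del hB (hP.lt n)).1.measurableSet
  by_cases h0 : μ n = 0
  · rcases hA with ⟨-, hA⟩ | hA
    · exact exists_continuous_separation hA (hP.ne_empty n) (hP.ne_univ n)
    · exact absurd hA.one_le (by simp [h0])
  · rcases h.slo A (hmeas hA) (P n) (hmeas (hP.mem n)) with h1 | h1
    · exact h1.mono fun f hf => continuous_of_mem_lipWith_one hf
    · obtain ⟨f, hf, hPf⟩ := h1.compl
      rw [compl_compl] at hPf
      have hA := hA.resolve_left fun h => h0 h.1
      exact absurd (hPf ▸ hA.preimage (continuous_of_mem_lipWith_one hf)) (hP.not_mem n h0)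

theorem sigmaSet_mem_gammaPlus (h : IsDetermined 𝒰 ξ) (hA𝒰 : A ∈ 𝒰)
    (hA : Selfdual (delFunctions ξ) A) (hP : IsAuxData ξ μ P) (e : ℕ × ℕ ≃ ℕ) :
    SigmaSet e P A ∈ GammaPlus (delFunctions ξ) ξ A := by
  have hQ : ∀ n, proj e (2 * n) ⁻¹' P n ∈ Del ξ := fun n =>
    mem_delFunctions_of_continuous (continuous_proj _ _) _ (PiC.mem_del (hP.mem n) (hP.lt n))
  let U : ℕ → Set Baire := fun n =>
    proj e (2 * n) ⁻¹' P n ∩ ⋂ i : Fin n, (proj e (2 * i) ⁻¹' P i)ᶜ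
  have hU : ∀ n x, x ∈ U n ↔ proj e (2 * n) x ∈ P n ∧ ∀ i < n, proj e (2 * i) x ∉ P i := by
    intro n x
    simp only [U, mem_inter_iff, mem_iInter, mem_compl_iff, mem_preimage, Fin.forall_iff]
  have := h.patch_mem_gammaPlus hA𝒰 hA (U := U) (k := fun n => proj e (2 * n + 1))
    (fun n => ((hQ n).1.inter (Del.iInter (ι := Fin n) h.one_le fun i => Del.compl (hQ i)).1))
    ((pairwise_disjoint_on U).2 fun m n hmn => Set.disjoint_left.2 fun x hx hx' =>
      ((hU n x).1 hx').2 m hmn ((hU m x).1 hx).1)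
    (fun n => mem_delFunctions_of_continuous (continuous_proj _ _))
  simp only [hU, and_assoc] at this
  exact this

theorem red_sigmaSet (h : IsDetermined 𝒰 ξ) (hA𝒰 : A ∈ 𝒰) (hA : Selfdual (delFunctions ξ) A)
    (hP : IsAuxData ξ μ P) (e : ℕ × ℕ ≃ ℕ) (hB : B ∈ GammaPlus (delFunctions ξ) ξ A) :
    Red W B (SigmaSet e P A) := by
  obtain ⟨D, C, hD, hdisj, hC, rfl⟩ := hB
  choose τ hτ hDτ using hD
  -- The piece D n is sent to the coordinate m n, where P is complex enough. Unused coordinates are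
  -- kept outside P, so by disjointness of the D n at most one coordinate is hit and the clause on
  -- earlier coordinates is automatic.
  obtain ⟨m, hm, hτm⟩ := extraction_forall_of_eventually (P := fun n k => τ n ≤ μ k) fun n => by
    obtain ⟨k, hk⟩ := hP.cofinal _ (hτ n)
    filter_upwards [eventually_ge_atTop k] with j hj using hk.trans (hP.mono hj)
  have : ∀ j, ∃ f g : Baire → Baire, Continuous f ∧ Continuous g ∧
      (∀ n, m n = j → D n = f ⁻¹' P j ∧ C n = g ⁻¹' A) ∧ ((∀ n, m n ≠ j) → ∀ x, f x ∉ P j) := by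
    intro j
    by_cases hj : ∃ n, m n = j
    · obtain ⟨n, rfl⟩ := hj
      obtain ⟨f, hf, hDf⟩ := h.red_auxData hP (hDτ n) (hτm n)
      obtain ⟨g, hg, hCg⟩ := h.lipRed_of_sred hA𝒰 hA (hC n)
      refine ⟨f, g, hf, continuous_of_mem_lipWith_one hg, fun n' hn' => ?_,
        fun h' => absurd rfl (h' n)⟩
      obtain rfl := hm.injective hn'
      exact ⟨hDf, hCg⟩
    · obtain ⟨q, hq⟩ := (ne_univ_iff_exists_notMem (P j)).1 (hP.ne_univ j)
      exact ⟨fun _ => q, id, continuous_const, continuous_id, fun n hn => absurd ⟨n, hn⟩ hj,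
        fun _ _ => hq⟩
  choose f g hf hg h1 h2 using this
  let k : ℕ → Baire → Baire := fun n => if n % 2 = 0 then f (n / 2) else g (n / 2)
  have hk : ∀ n, Continuous (k n) := by
    intro n
    by_cases hn : n % 2 = 0 <;> simp only [k, hn, if_true, if_false]
    exacts [hf _, hg _]
  let φ : Baire → Baire := fun x i => k (e.symm i).1 x (e.symm i).2
  have hφ : Continuous φ :=
    continuous_pi fun i => (continuous_apply (e.symm i).2).comp (hk (e.symm i).1)
  have hφk : ∀ n x, proj e n (φ x) = k n x := fun n x => by
    funext i
    simp [proj, φ]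
  have hφ0 : ∀ n x, proj e (2 * n) (φ x) = f n x := fun n x => by
    rw [hφk]
    simp [k]
  have hφ1 : ∀ n x, proj e (2 * n + 1) (φ x) = g n x := fun n x => by
    have h2 : (2 * n + 1) / 2 = n := by omega
    rw [hφk]
    simp [k, h2]
  refine ⟨φ, hφ, ?_⟩
  have hxD : ∀ x j, f j x ∈ P j → ∃ n, m n = j ∧ x ∈ D n := by
    intro x j hx
    by_cases hj : ∃ n, m n = j
    · obtain ⟨n, hn⟩ := hj
      refine ⟨n, hn, ?_⟩
      rw [(h1 j n hn).1]
      exact hx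
    · push Not at hj
      exact absurd hx (h2 j hj x)
  ext x
  simp only [mem_iUnion, mem_inter_iff, mem_preimage, SigmaSet, mem_ofPred_eq, hφ0, hφ1]
  constructor
  · rintro ⟨n, hn, hx⟩
    have h3 := h1 (m n) n rfl
    refine ⟨m n, (Set.ext_iff.1 h3.1 x).1 hn, fun i hi hx' => ?_, (Set.ext_iff.1 h3.2 x).1 hx⟩
    obtain ⟨n', rfl, hn'⟩ := hxD x i hx'
    exact Set.disjoint_left.1 (hdisj fun h : n = n' => by simp [h] at hi) hn hn'
  · rintro ⟨j, hj, -, hx⟩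
    obtain ⟨n, rfl, hn⟩ := hxD x j hj
    exact ⟨n, hn, (Set.ext_iff.1 (h1 (m n) n rfl).2 x).2 hx⟩

/-! ### Successors of selfdual degrees -/

theorem isNonselfdualPointclass_gammaPlus (h : IsDetermined 𝒰 ξ) (hA𝒰 : A ∈ 𝒰)
    (hA : Selfdual (delFunctions ξ) A) :
    IsNonselfdualPointclass (delFunctions ξ) (GammaPlus (delFunctions ξ) ξ A) := by
  obtain ⟨S, hS, hSc⟩ := h.exists_lipComplete_gammaPlus hA𝒰 hA
  refine ⟨⟨⟨S, hS⟩, fun B hB f hf => preimage_mem_gammaPlus h.amenable hf hB⟩, fun hne => ?_⟩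
  refine compl_notMem_of_lipComplete (fun B hB f hf => h.gammaPlus_preimage_continuous hf hB) hSc ?_
  rw [← hne] at hS
  exact hS

/-- Otherwise SLO reduces the complement of B to T, so B and its complement are both in Γ⁺(A), and B
reduces to A. -/
theorem red_of_not_red (h : IsDetermined 𝒰 ξ) (hA𝒰 : A ∈ 𝒰) (hA : Selfdual (delFunctions ξ) A)
    (hT : T ∈ GammaPlus (delFunctions ξ) ξ A) (hB : B ∈ GammaPlus (delFunctions ξ) ξ A)
    (hBA : ¬ Red (delFunctions ξ) B A) : Red (delFunctions ξ) T B := by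
  have hsub := h.gammaPlus_subset hA𝒰 hA
  rcases h.slo T (hsub hT) B (hsub hB) with h1 | h1
  · exact h.amenable.red_of_lip h1
  · obtain ⟨f, hf, hBf⟩ := h.amenable.red_of_lip h1
    refine absurd (red_of_mem_gammaPlus h.amenable hB ?_ hA) hBA
    rw [hBf]
    exact preimage_mem_gammaPlus h.amenable hf hT

/-- Compare a generator B of Λ with a complete set S of Γ⁺(A). Neither B nor its complement reduces
to A, for Λ would then contain both. The cases are whether S and its complement belong to Λ. -/
theorem eq_or_eq_dual_or_subset (h : IsDetermined 𝒰 ξ) (hA𝒰 : A ∈ 𝒰)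
    (hA : Selfdual (delFunctions ξ) A) (hΛ : Λ ⊆ 𝒰)
    (hΛ' : IsNonselfdualPointclass (delFunctions ξ) Λ) (hAΛ : A ∈ Λ) :
    Λ = GammaPlus (delFunctions ξ) ξ A ∨ Λ = dual (GammaPlus (delFunctions ξ) ξ A) ∨
      (GammaPlus (delFunctions ξ) ξ A ⊆ Λ ∧ dual (GammaPlus (delFunctions ξ) ξ A) ⊆ Λ) := by
  have hF := h.amenable
  obtain ⟨B, hB, hB', hBΛ, hBn⟩ := hΛ'.exists_generator hF.lip_one_subset h.slo hΛ
  obtain ⟨S, hS, hSc⟩ := h.exists_lipComplete_gammaPlus hA𝒰 hA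
  have hΓ𝒰 := h.gammaPlus_subset hA𝒰 hA
  have hcl : ∀ {C D}, Red (delFunctions ξ) C D → D ∈ Λ → C ∈ Λ := by
    rintro _ D ⟨f, hf, rfl⟩ hD
    exact hΛ'.1.2 D hD f hf
  have hclΓ : ∀ {C D}, Red (delFunctions ξ) C D → D ∈ GammaPlus (delFunctions ξ) ξ A →
      C ∈ GammaPlus (delFunctions ξ) ξ A := by
    rintro _ D ⟨f, hf, rfl⟩ hD
    exact preimage_mem_gammaPlus hF hf hD
  have hBcA : ¬ Red (delFunctions ξ) Bᶜ A := fun h' => hB' (hcl h' hAΛ)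
  have hBA : ¬ Red (delFunctions ξ) B A := fun h' =>
    hB' (hcl (hF.red_trans h'.compl hA.compl_red) hAΛ)
  by_cases h1 : S ∈ Λ
  · by_cases h2 : Sᶜ ∈ Λ
    · refine .inr (.inr ⟨fun C hC => hcl (hF.red_of_lip (hSc C hC)) h1, fun C hC => ?_⟩)
      exact hcl (red_compl_comm.2 (hF.red_of_lip (hSc _ hC))) h2
    · have h3 := hF.red_of_lip (red_compl_iff.1 (hBn _ (h.suitable.compl_mem _ (hΓ𝒰 hS)) h2))
      have h4 := h.red_of_not_red hA𝒰 hA hS (hclΓ h3 hS) hBA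
      refine .inl (Subset.antisymm (fun C hC => ?_) fun C hC => ?_)
      · exact hclΓ (hF.red_trans (hF.red_of_lip (hBΛ C hC)) h3) hS
      · exact hcl (hF.red_of_lip (hSc C hC)) h1
  · have h3 := hF.red_of_lip (hBn _ (hΓ𝒰 hS) h1)
    have h4 := h.red_of_not_red hA𝒰 hA hS (hclΓ h3 hS) hBcA
    refine .inr (.inl (Subset.antisymm (fun C hC => ?_) fun C hC => ?_))
    · exact hclΓ (hF.red_trans (hF.red_of_lip (hBΛ C hC)).compl h3) hS
    · exact hcl (red_compl_iff.1 (hF.red_trans (hF.red_of_lip (hSc _ hC)) h4)) hB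

theorem isSuccOf_of_complete (h : IsDetermined 𝒰 ξ) (hA𝒰 : A ∈ 𝒰)
    (hA : Selfdual (delFunctions ξ) A)
    (hT : IsCompleteFor (GammaPlus (delFunctions ξ) ξ A) T) : IsSuccOf (delFunctions ξ) A T := by
  have hF := h.amenable
  refine ⟨⟨?_, fun hTA => ?_⟩, ?_⟩
  · exact (hT.2 A (h.self_mem_gammaPlus hA𝒰 hA)).mono fun f => mem_delFunctions_of_continuous
  · obtain ⟨f, hf, hTf⟩ := hF.red_trans hTA.compl hA.compl_red
    refine h.compl_notMem_gammaPlus hA𝒰 hA hT.2 ?_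
    rw [hTf]
    exact preimage_mem_gammaPlus hF hf (h.self_mem_gammaPlus hA𝒰 hA)
  · rintro ⟨C, hAC, ⟨f, hf, hCf⟩, hTC⟩
    refine hTC (h.red_of_not_red hA𝒰 hA hT.1 ?_ hAC.2)
    rw [hCf]
    exact preimage_mem_gammaPlus hF hf hT.1

end IsDetermined

theorem IsSuccOf.compl (hF : IsAmenable F ξ) (hA : Selfdual F A) (h : IsSuccOf F A B) :
    IsSuccOf F A Bᶜ := by
  have key : ∀ C, SRed F A C → SRed F A Cᶜ := fun C hC =>
    ⟨hF.red_trans hA hC.1.compl, fun h' => hC.2 (red_compl_iff.1 (hF.red_trans h' hA))⟩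
  refine ⟨key B h.1, ?_⟩
  rintro ⟨C, hAC, hCB, hBC⟩
  exact h.2 ⟨Cᶜ, key C hAC, red_compl_comm.1 hCB, fun h' => hBC (red_compl_comm.1 h')⟩

namespace IsDetermined

/-- If B reduces to T or to its complement, `red_of_not_red` gives the equivalence. If it reduces to
neither, SLO puts T strictly between A and B. -/
theorem rEquiv_of_isSuccOf (h : IsDetermined 𝒰 ξ) (hA𝒰 : A ∈ 𝒰)
    (hA : Selfdual (delFunctions ξ) A)
    (hT : IsCompleteFor (GammaPlus (delFunctions ξ) ξ A) T) (hB𝒰 : B ∈ 𝒰)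
    (hB : IsSuccOf (delFunctions ξ) A B) :
    REquiv (delFunctions ξ) B T ∨ REquiv (delFunctions ξ) B Tᶜ := by
  have hF := h.amenable
  have hT𝒰 := h.gammaPlus_subset hA𝒰 hA hT.1
  have hmem : ∀ {C}, Red (delFunctions ξ) C T → C ∈ GammaPlus (delFunctions ξ) ξ A := by
    rintro _ ⟨f, hf, rfl⟩
    exact preimage_mem_gammaPlus hF hf hT.1
  rcases h.slo B hB𝒰 T hT𝒰 with h1 | h1
  · have h1 := hF.red_of_lip h1
    exact .inl ⟨h1, h.red_of_not_red hA𝒰 hA hT.1 (hmem h1) hB.1.2⟩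
  · have h1 := hF.red_of_lip h1
    rcases h.slo B hB𝒰 Tᶜ (h.suitable.compl_mem _ hT𝒰) with h2 | h2
    · have h2 := hF.red_of_lip h2
      have h3 := h.red_of_not_red hA𝒰 hA hT.1 (hmem (red_compl_comm.1 h2))
        (hB.compl hF hA).1.2
      exact .inr ⟨h2, red_compl_comm.1 h3⟩
    · rw [compl_compl] at h2
      have h2 := hF.red_of_lip h2
      by_cases h3 : Red (delFunctions ξ) B T
      · exact .inl ⟨h3, h2⟩
      · exact absurd ⟨T, (h.isSuccOf_of_complete hA𝒰 hA hT).1, h2, h3⟩ hB.2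

theorem rEquiv_of_complete (hS : IsCompleteFor Λ S) (hT : IsCompleteFor Λ T) :
    REquiv (delFunctions ξ) S T :=
  ⟨(hT.2 S hS.1).mono fun _ => mem_delFunctions_of_continuous,
    (hS.2 T hT.1).mono fun _ => mem_delFunctions_of_continuous⟩

theorem sigmaSet_complete (h : IsDetermined 𝒰 ξ) (hA𝒰 : A ∈ 𝒰)
    (hA : Selfdual (delFunctions ξ) A) (hP : IsAuxData ξ μ P) (e : ℕ × ℕ ≃ ℕ) :
    IsCompleteFor (GammaPlus (delFunctions ξ) ξ A) (SigmaSet e P A) :=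
  ⟨h.sigmaSet_mem_gammaPlus hA𝒰 hA hP e, fun _ hB => h.red_sigmaSet hA𝒰 hA hP e hB⟩

theorem compl_piSet_complete (h : IsDetermined 𝒰 ξ) (hA𝒰 : A ∈ 𝒰)
    (hA : Selfdual (delFunctions ξ) A) (hP : IsAuxData ξ μ P) (e : ℕ × ℕ ≃ ℕ) :
    IsCompleteFor (GammaPlus (delFunctions ξ) ξ A) (PiSet e P A)ᶜ := by
  rw [piSet_eq, compl_compl, ← gammaPlus_compl h.amenable hA]
  exact h.sigmaSet_complete (h.suitable.compl_mem A hA𝒰) hA.compl hP e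

theorem isSuccOf_piSet (h : IsDetermined 𝒰 ξ) (hA𝒰 : A ∈ 𝒰)
    (hA : Selfdual (delFunctions ξ) A) (hP : IsAuxData ξ μ P) (e : ℕ × ℕ ≃ ℕ) :
    IsSuccOf (delFunctions ξ) A (PiSet e P A) := by
  have := (h.isSuccOf_of_complete hA𝒰 hA (h.compl_piSet_complete hA𝒰 hA hP e)).compl h.amenable hA
  rwa [compl_compl] at this

end IsDetermined

/-! ### Transfer between sets of reductions of the same level -/

/-- The set of functions `F` induces the same reducibility as `𝚫⁰_ξ`-functions on the sets of
`𝒰`. -/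
def RedAgree (F : Set (Baire → Baire)) (𝒰 : Set (Set Baire)) (ξ : Ordinal.{0}) : Prop :=
  (∀ B C, C ∈ 𝒰 → (Red F B C ↔ Red (delFunctions ξ) B C)) ∧ ∀ B C, C ∈ 𝒰 → Red F B C → B ∈ 𝒰

namespace RedAgree

theorem sred_iff (h : RedAgree F 𝒰 ξ) (hA : A ∈ 𝒰) : SRed F C A ↔ SRed (delFunctions ξ) C A := by
  constructor
  · rintro ⟨h1, h2⟩
    exact ⟨(h.1 _ _ hA).1 h1, fun h' => h2 ((h.1 _ _ (h.2 _ _ hA h1)).2 h')⟩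
  · rintro ⟨h1, h2⟩
    have h1 := (h.1 _ _ hA).2 h1
    exact ⟨h1, fun h' => h2 ((h.1 _ _ (h.2 _ _ hA h1)).1 h')⟩

theorem gammaPlus_eq (h : RedAgree F 𝒰 ξ) (hA : A ∈ 𝒰) :
    GammaPlus F ξ A = GammaPlus (delFunctions ξ) ξ A := by
  simp only [GammaPlus, h.sred_iff hA]

theorem rEquiv_iff (h : RedAgree F 𝒰 ξ) (hA : A ∈ 𝒰) (hB : B ∈ 𝒰) :
    REquiv F A B ↔ REquiv (delFunctions ξ) A B :=
  and_congr (h.1 _ _ hB) (h.1 _ _ hA)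

theorem isSuccOf_iff (h : RedAgree F 𝒰 ξ) (hB : B ∈ 𝒰) :
    IsSuccOf F A B ↔ IsSuccOf (delFunctions ξ) A B := by
  refine and_congr (h.sred_iff hB) (not_congr (exists_congr fun C => ?_))
  constructor
  · rintro ⟨h1, h2⟩
    exact ⟨(h.sred_iff (h.2 _ _ hB h2.1)).1 h1, (h.sred_iff hB).1 h2⟩
  · rintro ⟨h1, h2⟩
    have h2 := (h.sred_iff hB).2 h2
    exact ⟨(h.sred_iff (h.2 _ _ hB h2.1)).2 h1, h2⟩

theorem isNonselfdualPointclass_iff (h : RedAgree F 𝒰 ξ) (hΛ : Λ ⊆ 𝒰) :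
    IsNonselfdualPointclass F Λ ↔ IsNonselfdualPointclass (delFunctions ξ) Λ := by
  have key : ∀ G : Set (Baire → Baire), (∀ B ∈ Λ, ∀ f ∈ G, f ⁻¹' B ∈ Λ) ↔
      ∀ B ∈ Λ, ∀ A, Red G A B → A ∈ Λ := fun G =>
    ⟨fun h B hB A ⟨f, hf, hA⟩ => hA ▸ h B hB f hf, fun h B hB f hf => h B hB _ ⟨f, hf, rfl⟩⟩
  refine and_congr (and_congr Iff.rfl ?_) Iff.rfl
  rw [key, key]
  exact forall₂_congr fun B hB => forall_congr' fun A => imp_congr (h.1 A B (hΛ hB)) Iff.rfl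

end RedAgree

theorem IsAmenable.redAgree (hF : IsAmenable F ξ) (h : IsDetermined 𝒰 ξ) : RedAgree F 𝒰 ξ :=
  ⟨fun _ _ hC => hF.red_iff_delFunctions h.suitable h.slo h.noFlipSet hC,
    fun _ _ hC hB => hF.mem_of_red h.suitable hC hB⟩

end BorelAmenable

end

section

open Set Filter Topology

namespace BorelAmenable

variable {ξ α β : Ordinal.{0}} {A B C : Set Baire} {f g : Baire → Baire}
  {F : Set (Baire → Baire)} {𝒰 Λ : Set (Set Baire)} {D : Ordinal.{0} → Set Baire} {x : Baire}

/-! ### The difference hierarchy -/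

theorem two_dvd_add_one_iff (η : Ordinal.{0}) : 2 ∣ η + 1 ↔ ¬ 2 ∣ η := by
  have h1 : ¬ (2 : Ordinal.{0}) ∣ 1 := fun h =>
    absurd (Ordinal.le_of_dvd one_ne_zero h) (not_le.2 one_lt_two)
  have h2 : η % 2 < 2 := Ordinal.mod_lt η two_ne_zero
  have h3 := Ordinal.div_add_mod η 2
  have h4 : (2 : Ordinal.{0}) ∣ 2 * (η / 2) := dvd_mul_right _ _
  have h2' : η % 2 ≤ 1 := by
    rwa [← Order.lt_add_one_iff, one_add_one_eq_two]
  rcases h2'.lt_or_eq with h0 | h0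
  · rw [Order.lt_one_iff] at h0
    rw [h0, add_zero] at h3
    rw [h3] at h4
    exact iff_of_false (fun h => h1 ((Ordinal.dvd_add_iff h4).1 h)) (not_not.2 h4)
  · rw [h0] at h3
    rw [← h3]
    refine iff_of_true ?_ fun h => h1 ((Ordinal.dvd_add_iff h4).1 h)
    rw [add_assoc, one_add_one_eq_two]
    exact (Ordinal.dvd_add_iff h4).2 dvd_rfl

/-- `η` is the least index of a set of the family `D` to which `x` belongs. -/
def IsLeastIndex (D : Ordinal.{0} → Set Baire) (x : Baire) (η : Ordinal.{0}) : Prop :=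
  x ∈ D η ∧ ∀ ζ < η, x ∉ D ζ

theorem IsLeastIndex.eq {η ζ : Ordinal.{0}} (h : IsLeastIndex D x η) (h' : IsLeastIndex D x ζ) :
    η = ζ :=
  le_antisymm (not_lt.1 fun hlt => h.2 _ hlt h'.1) (not_lt.1 fun hlt => h'.2 _ hlt h.1)

theorem isLeastIndex_congr {D' : Ordinal.{0} → Set Baire} {η : Ordinal.{0}}
    (h : ∀ ζ ≤ η, x ∈ D ζ ↔ x ∈ D' ζ) : IsLeastIndex D x η ↔ IsLeastIndex D' x η :=
  and_congr (h η le_rfl) (forall₂_congr fun ζ hζ => not_congr (h ζ hζ.le))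

theorem exists_isLeastIndex {η : Ordinal.{0}} (h : x ∈ D η) : ∃ ζ ≤ η, IsLeastIndex D x ζ := by
  obtain ⟨ζ, hζ, hmin⟩ := WellFounded.has_min (wellFounded_lt (α := Ordinal.{0}))
    {ζ | x ∈ D ζ} ⟨η, h⟩
  exact ⟨ζ, not_lt.1 (hmin η h), hζ, fun ρ hρ hx => hmin ρ hx hρ⟩

/-- The points whose least index in the family `(D_η)_{η < α}` has parity opposite to `α`. -/
def diffSet (D : Ordinal.{0} → Set Baire) (α : Ordinal.{0}) : Set Baire :=
  {x | ∃ η < α, IsLeastIndex D x η ∧ (2 ∣ η ↔ ¬ 2 ∣ α)}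

theorem mem_diffSet_iff {η : Ordinal.{0}} (h : IsLeastIndex D x η) :
    x ∈ diffSet D α ↔ η < α ∧ (2 ∣ η ↔ ¬ 2 ∣ α) := by
  constructor
  · rintro ⟨ζ, hζ, hl, hp⟩
    rw [h.eq hl]
    exact ⟨hζ, hp⟩
  · rintro ⟨h1, h2⟩
    exact ⟨η, h1, h, h2⟩

theorem notMem_diffSet (h : ∀ η < α, x ∉ D η) : x ∉ diffSet D α := by
  rintro ⟨η, hη, hl, -⟩
  exact h η hη hl.1

/-- Running unions do not change least indices, so the monotonicity demanded by `diffClass` costs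
nothing. -/
theorem isLeastIndex_accumulate {η : Ordinal.{0}} :
    IsLeastIndex (fun η => ⋃ ζ : Iic η, D ζ) x η ↔ IsLeastIndex D x η := by
  simp only [IsLeastIndex, mem_iUnion, Subtype.exists, mem_Iic, exists_prop]
  constructor
  · rintro ⟨⟨ζ, hζ, hx⟩, h⟩
    have : ∀ ρ < η, x ∉ D ρ := fun ρ hρ hx => h ρ hρ ⟨ρ, le_rfl, hx⟩
    rcases hζ.eq_or_lt with rfl | hlt
    · exact ⟨hx, this⟩
    · exact absurd hx (this ζ hlt)
  · rintro ⟨hx, h⟩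
    refine ⟨⟨η, le_rfl, hx⟩, ?_⟩
    rintro ρ hρ ⟨ζ, hζ, hx'⟩
    exact h ζ (hζ.trans_lt hρ) hx'

theorem diffSet_mem_diffClass (hξ : 1 ≤ ξ) (hα : α < ω₁) (hD : ∀ η < α, IsSigma ξ (D η)) :
    diffSet D α ∈ diffClass α ξ := by
  refine ⟨fun η => ⋃ ζ : Iic η, D ζ, fun η hη => ?_, fun ζ η hζη _ => ?_, ?_⟩
  · have := countable_Iio_of_lt_omega_one hα
    have : Countable (Iic η) := Function.Injective.countable (β := Iio α)
      (f := fun i : Iic η => ⟨i.1, i.2.trans_lt hη⟩)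
      fun i j h => Subtype.ext (congrArg (fun k : Iio α => k.1) h)
    exact IsSigma.iUnion_countable hξ fun i => hD _ (i.2.trans_lt hη)
  · exact iUnion_subset fun i => subset_iUnion_of_subset ⟨i.1, i.2.trans hζη⟩ Subset.rfl
  · ext x
    refine exists_congr fun η => and_congr_right fun _ => ?_
    rw [← isLeastIndex_accumulate (D := D), IsLeastIndex, and_assoc]

theorem exists_eq_diffSet (h : C ∈ diffClass α ξ) :
    ∃ D : Ordinal.{0} → Set Baire, (∀ η < α, IsSigma ξ (D η)) ∧ C = diffSet D α := by
  obtain ⟨D, hD, -, rfl⟩ := h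
  refine ⟨D, hD, ?_⟩
  ext x
  simp only [diffSet, mem_ofPred_eq, IsLeastIndex, and_assoc]

theorem diffClass_preimage (hf : f ∈ delFunctions ξ) (hB : B ∈ diffClass α ξ) :
    f ⁻¹' B ∈ diffClass α ξ := by
  obtain ⟨D, hD, hmono, rfl⟩ := hB
  exact ⟨fun η => f ⁻¹' D η, fun η hη => IsSigma.preimage_of_mem_delFunctions (hD η hη) hf,
    fun ζ η h h' => preimage_mono (hmono ζ η h h'), rfl⟩

theorem measurableSet_of_mem_diffClass (hα : α < ω₁) (hB : B ∈ diffClass α ξ) :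
    MeasurableSet B := by
  obtain ⟨D, hD, rfl⟩ := exists_eq_diffSet hB
  have h1 : ∀ η < α, Countable (Iio η) := fun η hη => countable_Iio_of_lt_omega_one (hη.trans hα)
  have h2 := countable_Iio_of_lt_omega_one hα
  have : diffSet D α = ⋃ η : Iio α, (D η ∩ ⋂ ζ : Iio η.1, (D ζ)ᶜ) ∩
      {_x | 2 ∣ η.1 ↔ ¬ 2 ∣ α} := by
    ext x
    simp [diffSet, IsLeastIndex]
    exact exists_congr fun η => and_left_comm
  rw [this]
  refine .iUnion fun η => ?_
  have := h1 η η.2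
  refine ((IsSigma.measurableSet (hD _ η.2)).inter (.iInter fun ζ => ?_)).inter (.const _)
  exact (IsSigma.measurableSet (hD _ (lt_trans ζ.2 η.2))).compl

theorem exists_lipComplete_diffClass (hξ : 1 ≤ ξ) (hξ' : ξ < ω₁) (hα : α < ω₁) :
    ∃ K ∈ diffClass α ξ, ∀ B ∈ diffClass α ξ, Red (LipWith 1) B K := by
  classical
  obtain ⟨T, hT, hTc⟩ := exists_lipComplete_isSigma hξ hξ'
  have := countable_Iio_of_lt_omega_one hα
  obtain ⟨c, hc⟩ := exists_injective_nat (Iio α)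
  let G : Ordinal.{0} → Set Baire := fun η =>
    if h : η < α then proj Nat.pairEquiv (c ⟨η, h⟩) ⁻¹' T else ∅
  refine ⟨diffSet G α, diffSet_mem_diffClass hξ hα fun η hη => ?_, fun B hB => ?_⟩
  · simp only [G, hη, dite_true]
    exact hT.preimage (continuous_proj _ _)
  · obtain ⟨D, hD, rfl⟩ := exists_eq_diffSet hB
    choose f hf hDf using fun η : Iio α => hTc _ (hD η.1 η.2)
    have hk : ∀ n, Function.extend c f (fun _ => id) n ∈ LipWith 1 := by
      intro n
      by_cases hn : ∃ η, c η = n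
      · obtain ⟨η, rfl⟩ := hn
        rw [hc.extend_apply]
        exact hf η
      · rw [Function.extend_apply' _ _ _ hn]
        exact id_mem_lipWith_one
    refine ⟨_, merge_mem_lipWith_one hk, ?_⟩
    ext x
    have key : ∀ η < α, x ∈ D η ↔
        (fun k => Function.extend c f (fun _ => id) k.unpair.1 x k.unpair.2) ∈ G η := by
      intro η hη
      simp only [G, hη, dite_true, mem_preimage, proj_merge, hc.extend_apply]
      rw [hDf ⟨η, hη⟩, mem_preimage]
    refine exists_congr fun η => and_congr_right fun hη => and_congr_left fun _ => ?_
    exact and_congr (key η hη) (forall₂_congr fun ζ hζ => not_congr (key ζ (hζ.trans hη)))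

theorem isNonselfdualPointclass_diffClass (hF : F ⊆ delFunctions ξ) (hξ : 1 ≤ ξ) (hξ' : ξ < ω₁)
    (hα : α < ω₁) : IsNonselfdualPointclass F (diffClass α ξ) := by
  obtain ⟨K, hK, hKc⟩ := exists_lipComplete_diffClass hξ hξ' hα
  refine ⟨⟨⟨K, hK⟩, fun B hB f hf => diffClass_preimage (hF hf) hB⟩, fun hne => ?_⟩
  refine compl_notMem_of_lipComplete
    (fun B hB f hf => diffClass_preimage (mem_delFunctions_of_continuous hf) hB) hKc ?_
  rw [← hne] at hK
  exact hK

theorem diffClass_subset_of_same_parity (hξ : 1 ≤ ξ) (hαβ : α ≤ β) (hβ : β < ω₁)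
    (hp : 2 ∣ α ↔ 2 ∣ β) : diffClass α ξ ⊆ diffClass β ξ := by
  classical
  intro C hC
  obtain ⟨D, hD, rfl⟩ := exists_eq_diffSet hC
  have : diffSet D α = diffSet (fun η => if η < α then D η else ∅) β := by
    have key : ∀ x, ∀ η < α, IsLeastIndex (fun η => if η < α then D η else ∅) x η ↔
        IsLeastIndex D x η := by
      intro x η hη
      exact isLeastIndex_congr fun ζ hζ => by rw [if_pos (hζ.trans_lt hη)]
    ext x
    constructor
    · rintro ⟨η, hη, hl, h⟩
      exact ⟨η, hη.trans_le hαβ, (key x η hη).2 hl, by rwa [← hp]⟩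
    · rintro ⟨η, -, hl, h⟩
      have hη : η < α := by
        by_contra hη
        have := hl.1
        simp [hη] at this
      exact ⟨η, hη, (key x η hη).1 hl, by rwa [hp]⟩
  rw [this]
  refine diffSet_mem_diffClass hξ hβ fun η _ => ?_
  split_ifs with h
  · exact hD η h
  · exact .of_isOpen isOpen_empty hξ

/-- Moving each D ζ to the index ζ + 1, with empty sets at 0 and at limits, reverses the parity of
every least index. -/
theorem diffClass_subset_of_opposite_parity (hξ : 1 ≤ ξ) (hαβ : α < β) (hβ : β < ω₁)
    (hp : 2 ∣ α ↔ ¬ 2 ∣ β) : diffClass α ξ ⊆ diffClass β ξ := by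
  intro C hC
  obtain ⟨D, hD, rfl⟩ := exists_eq_diffSet hC
  have hmem : ∀ x η, x ∈ (⋃ ζ : {ζ : Iio α // ζ.1 + 1 = η}, D ζ.1) ↔
      ∃ ζ < α, ζ + 1 = η ∧ x ∈ D ζ := by
    intro x η
    simp only [mem_iUnion, Subtype.exists, mem_Iio, exists_prop]
  have hlt : ∀ {ζ η : Ordinal.{0}}, ζ < η → ζ + 1 < η + 1 := fun h => by
    rwa [← Order.succ_eq_add_one, ← Order.succ_eq_add_one, Order.succ_lt_succ_iff]
  have hinj : ∀ {ζ η : Ordinal.{0}}, ζ + 1 = η + 1 → ζ = η := fun h => by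
    rwa [← Order.succ_eq_add_one, ← Order.succ_eq_add_one, Order.succ_eq_succ_iff] at h
  have key : ∀ x, ∀ η < α, IsLeastIndex (fun η => ⋃ ζ : {ζ : Iio α // ζ.1 + 1 = η}, D ζ.1) x (η + 1)
      ↔ IsLeastIndex D x η := by
    intro x η hη
    simp only [IsLeastIndex, hmem]
    constructor
    · rintro ⟨⟨ζ, hζ, hζη, hx⟩, h⟩
      obtain rfl := hinj hζη
      exact ⟨hx, fun ρ hρ hx => h (ρ + 1) (hlt hρ) ⟨ρ, hρ.trans hζ, rfl, hx⟩⟩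
    · rintro ⟨hx, h⟩
      refine ⟨⟨η, hη, rfl, hx⟩, ?_⟩
      rintro _ hρ ⟨ζ, hζ, rfl, hx'⟩
      refine h ζ (not_le.1 fun hle => ?_) hx'
      rcases hle.eq_or_lt with rfl | hlt'
      · exact lt_irrefl _ hρ
      · exact lt_asymm hρ (hlt hlt')
  have : diffSet D α = diffSet (fun η => ⋃ ζ : {ζ : Iio α // ζ.1 + 1 = η}, D ζ.1) β := by
    ext x
    constructor
    · rintro ⟨η, hη, hl, h⟩
      refine ⟨η + 1, (Order.add_one_le_of_lt hη).trans_lt hαβ, (key x η hη).2 hl, ?_⟩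
      rw [two_dvd_add_one_iff]
      tauto
    · rintro ⟨η, -, hl, h⟩
      obtain ⟨ζ, hζ, rfl, -⟩ := (hmem x η).1 hl.1
      refine ⟨ζ, hζ, (key x ζ hζ).1 hl, ?_⟩
      rw [two_dvd_add_one_iff] at h
      tauto
  rw [this]
  refine diffSet_mem_diffClass hξ hβ fun η _ => ?_
  have := countable_Iio_of_lt_omega_one (hαβ.trans hβ)
  exact IsSigma.iUnion_countable hξ fun ζ => hD _ ζ.1.2

theorem diffClass_subset (hξ : 1 ≤ ξ) (hαβ : α < β) (hβ : β < ω₁) :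
    diffClass α ξ ⊆ diffClass β ξ := by
  by_cases hp : 2 ∣ α ↔ 2 ∣ β
  · exact diffClass_subset_of_same_parity hξ hαβ.le hβ hp
  · exact diffClass_subset_of_opposite_parity hξ hαβ hβ (by tauto)

/-- Least indices below α are kept and judged by the opposite parity, which complements. Points in
no D η get the index α, whose parity admits them. -/
theorem dual_diffClass_subset_of_opposite_parity (hξ : 1 ≤ ξ) (hαβ : α < β) (hβ : β < ω₁)
    (hp : 2 ∣ α ↔ ¬ 2 ∣ β) : dual (diffClass α ξ) ⊆ diffClass β ξ := by
  classical
  intro C hC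
  obtain ⟨D, hD, hCD⟩ := exists_eq_diffSet hC
  have : C = diffSet (fun η => if η < α then D η else univ) β := by
    ext x
    rw [← not_iff_not, ← mem_compl_iff, hCD]
    by_cases h : ∃ η < α, x ∈ D η
    · obtain ⟨ρ, hρ, hx⟩ := h
      obtain ⟨η, hη, hl⟩ := exists_isLeastIndex hx
      have hηα := hη.trans_lt hρ
      have hl' : IsLeastIndex (fun η => if η < α then D η else univ) x η :=
        (isLeastIndex_congr fun ζ hζ => by rw [if_pos (hζ.trans_lt hηα)]).1 hl
      rw [mem_diffSet_iff hl, mem_diffSet_iff hl']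
      have := hηα.trans hαβ
      tauto
    · push Not at h
      refine iff_of_false (notMem_diffSet h) (not_not.2 ⟨α, hαβ, ⟨?_, fun ζ hζ => ?_⟩, hp⟩)
      · simp
      · simpa [hζ] using h ζ hζ
  rw [this]
  refine diffSet_mem_diffClass hξ hβ fun η _ => ?_
  split_ifs with h
  · exact hD η h
  · exact .of_isOpen isOpen_univ hξ

theorem dual_diffClass_subset (hξ : 1 ≤ ξ) (hαβ : α < β) (hβ : β < ω₁) :
    dual (diffClass α ξ) ⊆ diffClass β ξ := by
  by_cases hp : 2 ∣ α ↔ 2 ∣ β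
  · have h1 := two_dvd_add_one_iff α
    -- With equal parities β is not α + 1, and α + 1 serves as an intermediate length.
    have h2 : α + 1 < β := (Order.add_one_le_of_lt hαβ).lt_of_ne fun h => by
      rw [h] at h1
      tauto
    have h3 : α < α + 1 := Order.lt_add_one_iff.2 le_rfl
    exact (dual_diffClass_subset_of_opposite_parity hξ h3 (h2.trans hβ) (by tauto)).trans
      (diffClass_subset hξ h2 hβ)
  · exact dual_diffClass_subset_of_opposite_parity hξ hαβ hβ (by tauto)

/-- On one of the sets of the family, a difference is given by a shorter difference. -/
theorem mem_diffSet_iff_initial {η : Ordinal.{0}} (hη : η < α) (hx : x ∈ D η) :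
    x ∈ diffSet D α ↔ ((2 ∣ η ↔ 2 ∣ α) ↔ x ∈ diffSet D η) := by
  obtain ⟨ζ, hζ, hl⟩ := exists_isLeastIndex hx
  have := hζ.trans_lt hη
  rw [mem_diffSet_iff hl, mem_diffSet_iff hl]
  rcases hζ.eq_or_lt with rfl | hlt
  · have := lt_irrefl ζ
    tauto
  · tauto

/-- A set that, together with its complement, is in a difference class is selfdual as soon as it is
above all sets in the smaller difference classes and their duals. -/
theorem IsAmenable.selfdual_of_mem_diffClass (hF : IsAmenable F ξ) (hα : α < ω₁)
    (hB : B ∈ diffClass α ξ) (hB' : Bᶜ ∈ diffClass α ξ)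
    (h : ∀ η < α, ∀ K ∈ diffClass η ξ, Red F K Bᶜ ∧ Red F Kᶜ Bᶜ) : Selfdual F B := by
  classical
  obtain ⟨D, hD, hBD⟩ := exists_eq_diffSet hB
  obtain ⟨D', hD', hBD'⟩ := exists_eq_diffSet hB'
  have := countable_Iio_of_lt_omega_one hα
  have hK : ∀ {D : Ordinal.{0} → Set Baire}, (∀ η < α, IsSigma ξ (D η)) → ∀ η < α,
      diffSet D η ∈ diffClass η ξ := fun hD η hη =>
    diffSet_mem_diffClass hF.one_le (hη.trans hα) fun ζ hζ => hD ζ (hζ.trans hη)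
  -- The D η cover B and the D' η cover its complement. On each of them B is a difference of length
  -- η or the complement of one, as parity dictates.
  refine hF.red_of_cover (ι := Iio α ⊕ Iio α) (D := Sum.elim (fun η => D η) fun η => D' η)
    (C := Sum.elim (fun η => if (2 ∣ η.1 ↔ 2 ∣ α) then diffSet D η else (diffSet D η)ᶜ)
      fun η => if (2 ∣ η.1 ↔ 2 ∣ α) then (diffSet D' η)ᶜ else diffSet D' η) ?_ ?_ ?_ ?_
  · rintro (η | η)
    · exact hD η η.2
    · exact hD' η η.2
  · intro x
    by_cases hx : x ∈ B
    · rw [hBD] at hx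
      obtain ⟨η, hη, hl, -⟩ := hx
      exact ⟨.inl ⟨η, hη⟩, hl.1⟩
    · rw [← mem_compl_iff, hBD'] at hx
      obtain ⟨η, hη, hl, -⟩ := hx
      exact ⟨.inr ⟨η, hη⟩, hl.1⟩
  · rintro (η | η)
    · have := h η η.2 _ (hK hD η η.2)
      simp only [Sum.elim_inl]
      split_ifs
      exacts [this.1, this.2]
    · have := h η η.2 _ (hK hD' η η.2)
      simp only [Sum.elim_inr]
      split_ifs
      exacts [this.2, this.1]
  · rintro (η | η) x hx
    · have := mem_diffSet_iff_initial η.2 hx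
      rw [← hBD] at this
      rw [this, Sum.elim_inl]
      split_ifs with hp
      · exact iff_true_left hp
      · rw [mem_compl_iff]
        tauto
    · have := mem_diffSet_iff_initial η.2 hx
      rw [← hBD', mem_compl_iff] at this
      rw [← not_iff_not, this, Sum.elim_inr]
      split_ifs with hp
      · rw [mem_compl_iff]
        tauto
      · tauto

/-- A nonselfdual pointclass is one of the difference classes or their duals, or it includes all of
them. -/
theorem IsAmenable.eq_diffClass_or_subset (hF : IsAmenable F ξ) (h𝒰 : IsSuitable 𝒰)
    (hSLO : SLOL 𝒰) (hΛ : Λ ⊆ 𝒰) (hΛ' : IsNonselfdualPointclass F Λ) :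
    (∃ α < ω₁, Λ = diffClass α ξ ∨ Λ = dual (diffClass α ξ)) ∨
      ∀ α < ω₁, diffClass α ξ ⊆ Λ ∧ dual (diffClass α ξ) ⊆ Λ := by
  obtain ⟨B, hB, hB', hBΛ, hBn⟩ := hΛ'.exists_generator hF.lip_one_subset hSLO hΛ
  by_contra hcon
  push Not at hcon
  obtain ⟨hne, hex⟩ := hcon
  obtain ⟨α, ⟨hα, hαΛ⟩, hmin⟩ := WellFounded.has_min (wellFounded_lt (α := Ordinal.{0}))
    {α | α < ω₁ ∧ ¬ (diffClass α ξ ⊆ Λ ∧ dual (diffClass α ξ) ⊆ Λ)}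
    (by obtain ⟨α, hα, h⟩ := hex; exact ⟨α, hα, fun h' => h h'.1 h'.2⟩)
  have hlow : ∀ η < α, diffClass η ξ ⊆ Λ ∧ dual (diffClass η ξ) ⊆ Λ := fun η hη => by
    by_contra h
    exact hmin η ⟨hη.trans hα, h⟩ hη
  have hsub : diffClass α ξ ⊆ 𝒰 := fun C hC =>
    h𝒰.borel_mem C (measurableSet_of_mem_diffClass hα hC)
  have hlip : ∀ {C K}, Red (LipWith 1) C K → K ∈ diffClass α ξ → C ∈ diffClass α ξ := by
    rintro _ K ⟨f, hf, rfl⟩ hK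
    exact diffClass_preimage (mem_delFunctions_of_continuous (continuous_of_mem_lipWith_one hf)) hK
  have h1 : ¬ diffClass α ξ ⊆ Λ → Bᶜ ∈ diffClass α ξ := fun h => by
    obtain ⟨K, hK, hKΛ⟩ := not_subset.1 h
    exact hlip (hBn K (hsub hK) hKΛ) hK
  have h2 : ¬ dual (diffClass α ξ) ⊆ Λ → B ∈ diffClass α ξ := fun h => by
    obtain ⟨K, hK, hKΛ⟩ := not_subset.1 h
    exact hlip (red_compl_comm.2 (hBn K (dual_subset h𝒰 hsub hK) hKΛ)) hK
  have h3 : Bᶜ ∈ diffClass α ξ → Λ ⊆ dual (diffClass α ξ) := fun h C hC =>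
    hlip (hBΛ C hC).compl h
  have h4 : B ∈ diffClass α ξ → Λ ⊆ diffClass α ξ := fun h C hC => hlip (hBΛ C hC) h
  -- If only one of the two classes failed to be included in Λ, then Λ would equal the other one.
  have hboth : B ∈ diffClass α ξ ∧ Bᶜ ∈ diffClass α ξ := by
    by_cases h : diffClass α ξ ⊆ Λ
    · have h5 := h2 fun h' => hαΛ ⟨h, h'⟩
      exact absurd (Subset.antisymm (h4 h5) h) (hne α hα).1
    · refine ⟨h2 fun h' => ?_, h1 h⟩
      exact (hne α hα).2 (Subset.antisymm (h3 (h1 h)) h')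
  have hsd := hF.selfdual_of_mem_diffClass hα hboth.1 hboth.2 fun η hη K hK => by
    have hK1 : Red F K B := hF.red_of_lip (hBΛ _ ((hlow η hη).1 hK))
    have hK2 : Red F Kᶜ B := hF.red_of_lip (hBΛ _ ((hlow η hη).2 (by
      rw [dual, mem_ofPred_eq, compl_compl]; exact hK)))
    exact ⟨red_compl_comm.2 hK2, hK1.compl⟩
  obtain ⟨f, hf, hBf⟩ := hsd.compl_red
  exact hB' (hBf ▸ hΛ'.1.2 B hB f hf)

end BorelAmenable

end

/-! ### Transfer from 𝚫⁰_ξ-functions to F, and conclusion -/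

open BorelAmenable in
theorem mainTheorem11 (𝒰 : Set (Set Baire)) (h𝒰 : IsSuitable 𝒰)
    (hSLO : SLOL 𝒰) (hFS : NoFlipSet 𝒰)
    (F : Set (Baire → Baire)) (hF : IsBorelAmenable F)
    (ξ : Ordinal.{0}) (hξ : 1 ≤ ξ) (hξ' : ξ < ω₁) (hlevel : charSet F = Del ξ) :
    (∀ A ∈ 𝒰, Selfdual F A →
      -- `Γ⁺(A)` and its dual are the smallest nonselfdual pointclasses containing `A`
      (IsNonselfdualPointclass F (GammaPlus F ξ A) ∧
        IsNonselfdualPointclass F (dual (GammaPlus F ξ A)) ∧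
        GammaPlus F ξ A ⊆ 𝒰 ∧ A ∈ GammaPlus F ξ A ∧ A ∈ dual (GammaPlus F ξ A) ∧
        ∀ Λ : Set (Set Baire), Λ ⊆ 𝒰 → IsNonselfdualPointclass F Λ → A ∈ Λ →
          Λ = GammaPlus F ξ A ∨ Λ = dual (GammaPlus F ξ A) ∨
            (GammaPlus F ξ A ⊆ Λ ∧ dual (GammaPlus F ξ A) ⊆ Λ)) ∧
      -- the explicit complete sets, and the successors of the degree of `A`
      (∀ (e : ℕ × ℕ ≃ ℕ) (μ : ℕ → Ordinal.{0}) (P : ℕ → Set Baire), IsAuxData ξ μ P →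
        IsCompleteFor (GammaPlus F ξ A) (SigmaSet e P A) ∧
        IsCompleteFor (dual (GammaPlus F ξ A)) (PiSet e P A) ∧
        REquiv F (PiSet e P A) (SigmaSet e P A)ᶜ ∧
        ¬ Selfdual F (SigmaSet e P A) ∧
        IsSuccOf F A (SigmaSet e P A) ∧ IsSuccOf F A (PiSet e P A) ∧
        ∀ B ∈ 𝒰, IsSuccOf F A B →
          REquiv F B (SigmaSet e P A) ∨ REquiv F B (PiSet e P A))) ∧
    -- the first `ω₁` pairs of nonselfdual pointclasses
    ((∀ α < ω₁, IsNonselfdualPointclass F (diffClass α ξ) ∧ diffClass α ξ ⊆ 𝒰) ∧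
      (∀ α β, α < β → β < ω₁ →
        diffClass α ξ ⊆ diffClass β ξ ∧ dual (diffClass α ξ) ⊆ diffClass β ξ) ∧
      ∀ Λ : Set (Set Baire), Λ ⊆ 𝒰 → IsNonselfdualPointclass F Λ →
        (∃ α < ω₁, Λ = diffClass α ξ ∨ Λ = dual (diffClass α ξ)) ∨
          ∀ α < ω₁, diffClass α ξ ⊆ Λ ∧ dual (diffClass α ξ) ⊆ Λ) := by
  have hAm := hF.isAmenable hξ hlevel
  have h : IsDetermined 𝒰 ξ := ⟨h𝒰, hSLO, hFS, hξ, hξ'⟩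
  have hR := hAm.redAgree h
  refine ⟨fun A hA𝒰 hsd => ?_, ⟨fun α hα => ⟨?_, ?_⟩, fun α β hαβ hβ => ?_, fun Λ hΛ hΛ' => ?_⟩⟩
  · have hA : Selfdual (delFunctions ξ) A := (hR.1 _ _ (h𝒰.compl_mem A hA𝒰)).1 hsd
    have hΓ := h.gammaPlus_subset hA𝒰 hA
    have hΓns := h.isNonselfdualPointclass_gammaPlus hA𝒰 hA
    rw [hR.gammaPlus_eq hA𝒰, hR.isNonselfdualPointclass_iff hΓ,
      hR.isNonselfdualPointclass_iff (dual_subset h𝒰 hΓ)]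
    have hAΓ := h.self_mem_gammaPlus hA𝒰 hA
    refine ⟨⟨hΓns, hΓns.dual, hΓ, hAΓ, ?_, fun Λ hΛ hΛ' hAΛ => ?_⟩, fun e μ P hP => ?_⟩
    · obtain ⟨f, hf, hAf⟩ := hA.compl_red
      exact (hAf ▸ hΓns.1.2 A hAΓ f hf : Aᶜ ∈ _)
    · exact h.eq_or_eq_dual_or_subset hA𝒰 hA hΛ ((hR.isNonselfdualPointclass_iff hΛ).1 hΛ') hAΛ
    · have hS := h.sigmaSet_complete hA𝒰 hA hP e
      have hP' := h.compl_piSet_complete hA𝒰 hA hP e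
      have hS𝒰 := hΓ hS.1
      have hP𝒰 : PiSet e P A ∈ 𝒰 := by simpa using h𝒰.compl_mem _ (hΓ hP'.1)
      have hS'𝒰 := h𝒰.compl_mem _ hS𝒰
      have heq : REquiv (delFunctions ξ) (PiSet e P A) (SigmaSet e P A)ᶜ := by
        have h1 := IsDetermined.rEquiv_of_complete (ξ := ξ) hP' hS
        exact ⟨red_compl_comm.2 h1.1, red_compl_comm.1 h1.2⟩
      rw [hR.rEquiv_iff hP𝒰 hS'𝒰, hR.isSuccOf_iff hS𝒰, hR.isSuccOf_iff hP𝒰]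
      refine ⟨hS, ⟨hP'.1, fun B hB => red_compl_iff.1 (hP'.2 _ hB)⟩, heq, fun hsd' => ?_,
        h.isSuccOf_of_complete hA𝒰 hA hS, h.isSuccOf_piSet hA𝒰 hA hP e, fun B hB𝒰 hB => ?_⟩
      · have hsd'' : Selfdual (delFunctions ξ) (SigmaSet e P A) := (hR.1 _ _ hS'𝒰).1 hsd'
        obtain ⟨f, hf, hSf⟩ := hsd''.compl_red
        exact h.compl_notMem_gammaPlus hA𝒰 hA hS.2 (hSf ▸ hΓns.1.2 _ hS.1 f hf)
      · rw [hR.rEquiv_iff hB𝒰 hS𝒰, hR.rEquiv_iff hB𝒰 hP𝒰]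
        refine (h.rEquiv_of_isSuccOf hA𝒰 hA hS hB𝒰 ((hR.isSuccOf_iff hB𝒰).1 hB)).imp_right
          fun h1 => ?_
        exact ⟨h.amenable.red_trans h1.1 heq.2, h.amenable.red_trans heq.1 h1.2⟩
  · exact isNonselfdualPointclass_diffClass hAm.subset_delFunctions hξ hξ' hα
  · exact fun B hB => h𝒰.borel_mem B (measurableSet_of_mem_diffClass hα hB)
  · exact ⟨diffClass_subset hξ hαβ hβ, dual_diffClass_subset hξ hαβ hβ⟩
  · exact hAm.eq_diffClass_or_subset h𝒰 hSLO hΛ hΛ'
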